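/- **Setting.** Let $d\ge 1$ and $m\ge 2$. For each $j\in[m]$ let $\mathcal P_j$ be a probability distribution on a sample space $\mathbb X_j$, let $\ell_j:\mathbb R^d\times\mathbb X_j\to\mathbb R$ be a loss function, measurable in its second argument and with finite population risk $F_j(\theta)=\mathbb E_{\xi\sim\mathcal P_j}\ell_j(\theta,\xi)$ for all $\theta\in\mathbb R^d$, and let $\theta^\star_j\in\operatorname{argmin}_{\theta\in\mathbb R^d}F_j(\theta)$. Let $\{\xi_{ji}\}_{1\le i\le n_j,\,1\le j\le m}$ be independent with $\xi_{ji}\sim\mathcal P_j$, put $n=\min_{j} n_j$, assume $n\ge 2$, and let $f_j(\theta)=\frac1{n_j}\sum_{i=1}^{n_j}\ell_j(\theta,\xi_{ji})$. Gradients and Hessians are in $\theta$; $\|\cdot\|_2$ is the Euclidean norm on vectors and the spectral norm on matrices; $B(x,r)$ is the closed Euclidean ball; for a real random variable $\|X\|_{\psi_2}=\sup_{q\ge1}q^{-1/2}(\mathbb E|X|^q)^{1/q}$ and $\|X\|_{\psi_1}=\sup_{q\ge1}q^{-1}(\mathbb E|X|^q)^{1/q}$, and for a random vector $\|X\|_{\psi_2}=\sup_{\|u\|_2=1}\|\langle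 u,X\rangle\|_{\psi_2}$. Fix constants $c_1,c_2,c>0$ and assume that for some $\rho,L,M\in(c_1,c_2)$ and $\sigma,\tau,p\in[0,c)$ the following hold for all $j\in[m]$. *(Regularity)* For every $\xi\in\mathbb X_j$, $\ell_j(\cdot,\xi)$ is convex and twice differentiable on $\mathbb R^d$, and $\rho I\preceq\nabla^2F_j(\theta)\preceq LI$ for all $\theta\in B(\theta^\star_j,M)$. *(Concentration)* With $\xi\sim\mathcal P_j$: $\|\nabla\ell_j(\theta^\star_j,\xi)\|_{\psi_2}\le\sigma$; $\|\langle(\nabla^2\ell_j(\theta,\xi)-\mathbb E\nabla^2\ell_j(\theta,\xi))v,v\rangle\|_{\psi_1}\le\tau^2$ for all $\theta\in B(\theta^\star_j,M)$ and $\|v\|_2=1$; and $\mathbb E\,Q_j(\xi)\le\tau^3d^p$, where $$Q_j(\xi)=\sup_{\theta_1\ne\theta_2\in B(\theta^\star_j,M)}\frac{\|\nabla^2\ell_j(\theta_2,\xi)-\nabla^2\ell_j(\theta_1,\xi)\|_2}{\|\theta_2-\theta_1\|_2}$$ (with $Q_j$ measurable up to $\mathcal P_j$-null sets). **Theorem (Personalization).**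 There are constants $C,C_1,C_2>0$, depending only on $c_1,c_2,c$, such that in the above setting, for all weights $w_j>0$ and all penalty levels $\lambda_j\ge0$ with $\max_j\lambda_j<\rho M/4$, if $n>C_1\,d\,(\log n)(\log m)$ and $0\le t<C_2\,n/(d\log n)$, then with probability at least $1-e^{-t}$ the following holds. For every $j\in[m]$ the empirical loss $f_j$ has a unique minimizer $\widetilde\theta_j$ over $\mathbb R^d$, and $$\|\widetilde\theta_j-\theta^\star_j\|_2\le C\sqrt{\frac{d+\log m+t}{n_j}},\qquad\forall j\in[m];$$ moreover, for every constraint set $\Omega\subseteq\mathbb R^{d\times m}$ and every $$(\widehat\Theta,\widehat\Gamma)\in\operatorname*{argmin}_{\Theta\in\mathbb R^{d\times m},\ \Gamma\in\Omega}\ \sum_{j=1}^m w_j\big[f_j(\theta_j)+\lambda_j\|\theta_j-\gamma_j\|_2\big],$$ where $\theta_j,\gamma_j$ are the $j$-th columns of $\Theta,\Gamma$, the columns $\widehat\theta_j$ of $\widehat\Theta$ satisfy $$\|\widehat\theta_j-\widetilde\theta_j\|_2\le\frac{2\lambda_j}{\rho},\qquad\forall j\in[m].$$ -/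

import Mathlib

open MeasureTheory ProbabilityTheory

noncomputable section

namespace ARMUL

/-- The parameter space `ℝ^d` with its Euclidean norm. -/
abbrev Param (d : ℕ) : Type := EuclideanSpace ℝ (Fin d)

/-- The Hessian of `f` at `θ`, as a linear operator on `ℝ^d` (so its norm is the spectral norm). -/
def hessian {d : ℕ} (f : Param d → ℝ) (θ : Param d) : Param d →L[ℝ] Param d :=
  fderiv ℝ (gradient f) θ

/-- `‖X‖_{ψ₂} = sup_{q ≥ 1} q^{-1/2} (E|X|^q)^{1/q}` for a real random variable `X`. -/
def psiTwoNorm {S : Type*} [MeasurableSpace S] (P : Measure S) (X : S → ℝ) : ENNReal :=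
  ⨆ (q : ℝ) (_ : 1 ≤ q),
    ENNReal.ofReal (q ^ (-(1 / 2) : ℝ)) * eLpNorm X (ENNReal.ofReal q) P

/-- `‖X‖_{ψ₁} = sup_{q ≥ 1} q^{-1} (E|X|^q)^{1/q}` for a real random variable `X`. -/
def psiOneNorm {S : Type*} [MeasurableSpace S] (P : Measure S) (X : S → ℝ) : ENNReal :=
  ⨆ (q : ℝ) (_ : 1 ≤ q),
    ENNReal.ofReal (q ^ (-1 : ℝ)) * eLpNorm X (ENNReal.ofReal q) P

/-- `‖X‖_{ψ₂} = sup_{‖u‖ = 1} ‖⟨u, X⟩‖_{ψ₂}` for a random vector `X`. -/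
def psiTwoNormVec {S : Type*} [MeasurableSpace S] {d : ℕ} (P : Measure S) (X : S → Param d) :
    ENNReal :=
  ⨆ (u : Param d) (_ : ‖u‖ = 1), psiTwoNorm P (fun x => inner ℝ u (X x))

/-- The population loss `F(θ) = E_{x ∼ P} ℓ(θ, x)`. -/
def popLoss {S : Type*} [MeasurableSpace S] {d : ℕ} (P : Measure S) (ℓ : Param d → S → ℝ)
    (θ : Param d) : ℝ :=
  ∫ x, ℓ θ x ∂P

/-- The empirical loss `f(θ) = (1/n) ∑ᵢ ℓ(θ, xᵢ)` of a data set `x₁, …, xₙ`. -/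
def empLoss {S : Type*} {d n : ℕ} (ℓ : Param d → S → ℝ) (x : Fin n → S) (θ : Param d) : ℝ :=
  (1 / (n : ℝ)) * ∑ i, ℓ θ (x i)

/-- The Lipschitz constant (possibly `∞`) of `θ ↦ ∇²ℓ(θ, x)` on the closed ball `B(θ⋆, M)`. -/
def hessianLip {S : Type*} {d : ℕ} (ℓ : Param d → S → ℝ) (θs : Param d) (M : ℝ) (x : S) :
    ENNReal :=
  ⨆ (θ₁ ∈ Metric.closedBall θs M) (θ₂ ∈ Metric.closedBall θs M) (_ : θ₁ ≠ θ₂),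
    ENNReal.ofReal
      (‖hessian (fun θ => ℓ θ x) θ₂ - hessian (fun θ => ℓ θ x) θ₁‖ / ‖θ₂ - θ₁‖)

/-- A learning task: the loss is measurable in the sample and has a finite expectation at every
parameter, and `θ⋆` minimizes the population loss over `ℝ^d`. -/
structure IsTask {S : Type*} [MeasurableSpace S] {d : ℕ} (P : Measure S) (ℓ : Param d → S → ℝ)
    (θs : Param d) : Prop where
  measurable : ∀ θ, Measurable (ℓ θ)
  integrable : ∀ θ, Integrable (ℓ θ) P
  isMin : IsMinOn (popLoss P ℓ) Set.univ θs

/-- Regularity of one task: the loss is convex and twice differentiable in the parameter, and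
`ρ I ⪯ ∇²F(θ) ⪯ L I` for `θ ∈ B(θ⋆, M)`. (As `ρ > 0` where this is used, the lower bound cannot
hold for the default value `0` of a derivative that does not exist.) -/
structure Regularity {S : Type*} [MeasurableSpace S] {d : ℕ} (P : Measure S)
    (ℓ : Param d → S → ℝ) (θs : Param d) (ρ L M : ℝ) : Prop where
  convex : ∀ x, ConvexOn ℝ Set.univ (fun θ => ℓ θ x)
  differentiable : ∀ x, Differentiable ℝ (fun θ => ℓ θ x)
  differentiable_gradient : ∀ x, Differentiable ℝ (gradient (fun θ => ℓ θ x))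
  hessian_lower : ∀ θ ∈ Metric.closedBall θs M, ∀ v : Param d,
    ρ * ‖v‖ ^ 2 ≤ inner ℝ (hessian (popLoss P ℓ) θ v) v
  hessian_upper : ∀ θ ∈ Metric.closedBall θs M, ∀ v : Param d,
    inner ℝ (hessian (popLoss P ℓ) θ v) v ≤ L * ‖v‖ ^ 2

/-- Concentration for one task. -/
structure Concentration {S : Type*} [MeasurableSpace S] {d : ℕ} (P : Measure S)
    (ℓ : Param d → S → ℝ) (θs : Param d) (M σ τ p : ℝ) : Prop where
  gradient_subGaussian :
    psiTwoNormVec P (fun x => gradient (fun θ => ℓ θ x) θs) ≤ ENNReal.ofReal σ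
  hessian_subExponential : ∀ θ ∈ Metric.closedBall θs M, ∀ v : Param d, ‖v‖ = 1 →
    psiOneNorm P (fun x =>
      inner ℝ ((hessian (fun θ' => ℓ θ' x) θ - ∫ y, hessian (fun θ' => ℓ θ' y) θ ∂P) v) v)
      ≤ ENNReal.ofReal (τ ^ 2)
  hessianLip_aemeasurable : AEMeasurable (hessianLip ℓ θs M) P
  hessianLip_mean : ∫⁻ x, hessianLip ℓ θs M x ∂P ≤ ENNReal.ofReal (τ ^ 3 * (d : ℝ) ^ p)

/-- The ARMUL objective `∑ⱼ wⱼ [fⱼ(θⱼ) + λⱼ ‖θⱼ - γⱼ‖₂]`; a `d × m` matrix is given by its `m`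
columns. -/
def objective {d m : ℕ} (w lam : Fin m → ℝ) (f : Fin m → Param d → ℝ)
    (Θ Γ : Fin m → Param d) : ℝ :=
  ∑ j, w j * (f j (Θ j) + lam j * ‖Θ j - Γ j‖)

/-- `(Θ, Γ)` minimizes the ARMUL objective over `Θ ∈ ℝ^{d×m}` and `Γ ∈ Om`. -/
def IsSolution {d m : ℕ} (w lam : Fin m → ℝ) (f : Fin m → Param d → ℝ)
    (Om : Set (Fin m → Param d)) (Θ Γ : Fin m → Param d) : Prop :=
  Γ ∈ Om ∧ ∀ Θ' : Fin m → Param d, ∀ Γ' ∈ Om,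
    objective w lam f Θ Γ ≤ objective w lam f Θ' Γ'

end ARMUL

end

/-! Deterministic core. Suppose a convex `f` has curvature at least `ρ / 2` on the ball of radius
`M` about `θs` and a small gradient at `θs`. Then its minimizer is unique and lies within `2 / ρ *
‖∇f(θs)‖` of `θs`. A point that minimizes `f` up to a penalty `lam * ‖θ - θ'‖` has slope at most
`lam` towards that minimizer. Curvature near the minimizer, and monotonicity of the gradient beyond,
force this slope to be at least `ρ / 2 * min R (M / 2)` at distance `R`; as `lam < ρ * M / 4`, this
gives `R ≤ 2 * lam / ρ` (`exists_minimizer_of_curvature`). Each column of an ARMUL solution is such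
a point whatever the constraint set, by freezing `Γ` and using the triangle inequality
(`IsSolution.le_add_mul_norm`).

Probabilistic core. The gradient at `θs` is a centred sub-Gaussian average, handled by Chernoff over
a net of the sphere (`measure_gradient_empLoss_gt_le`). For the Hessian only a lower bound is
needed. Its quadratic forms are nonnegative by convexity, so second moments alone give an
exponential lower tail at a fixed point and direction (`integral_exp_neg_le`). A net of ball times
sphere makes this uniform (`measure_hessian_empLoss_lt_le`). The random Lipschitz constant has only
a mean, so Markov is used at a level `R` of order `exp s` times a power of `d`. The mesh is of order
`1 / R` and the net entropy of order `d * (1 + log d + s)`, which is what the sample size must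
dominate (`exists_tuning`). With `s = t + log m`, a union bound over the tasks finishes the proof.
-/

namespace ARMUL

/-! ### Convex functions with curvature near a point -/

section Deterministic

variable {d : ℕ} {f : Param d → ℝ}

lemma hasDerivAt_comp_line (hf : Differentiable ℝ f) (a u : Param d) (s : ℝ) :
    HasDerivAt (fun s : ℝ => f (a + s • u)) (inner ℝ (gradient f (a + s • u)) u) s := by
  have h1 : HasDerivAt (fun s : ℝ => a + s • u) u s := by
    simpa using ((hasDerivAt_id s).smul_const u).const_add a
  exact (hf (a + s • u)).hasGradientAt.hasFDerivAt.comp_hasDerivAt s h1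

lemma hasDerivAt_inner_gradient_line (hg : Differentiable ℝ (gradient f)) (a u v : Param d)
    (s : ℝ) :
    HasDerivAt (fun s : ℝ => inner ℝ (gradient f (a + s • u)) v)
      (inner ℝ (hessian f (a + s • u) u) v) s := by
  have h1 : HasDerivAt (fun s : ℝ => a + s • u) u s := by
    simpa using ((hasDerivAt_id s).smul_const u).const_add a
  have h2 := (hg (a + s • u)).hasFDerivAt.comp_hasDerivAt s h1
  simpa [hessian] using h2.inner ℝ (hasDerivAt_const s v)

/-- A convex function restricted to a line is convex in one variable, so its derivative increases.
This keeps gradient growth from being lost where no curvature bound is available. -/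
lemma monotone_inner_gradient_line (hc : ConvexOn ℝ Set.univ f) (hf : Differentiable ℝ f)
    (a u : Param d) : Monotone (fun s : ℝ => inner ℝ (gradient f (a + s • u)) u) := by
  have hconv : ConvexOn ℝ Set.univ (fun s : ℝ => f (a + s • u)) := by
    have := hc.comp_affineMap (AffineMap.lineMap a (a + u) : ℝ →ᵃ[ℝ] Param d)
    simpa [Function.comp_def, AffineMap.lineMap_apply, add_comm] using this
  have hd := fun s => hasDerivAt_comp_line hf a u s
  have hm := hconv.monotoneOn_deriv fun s _ => (hd s).differentiableAt
  intro s t hst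
  have := hm (Set.mem_univ s) (Set.mem_univ t) hst
  rwa [(hd s).deriv, (hd t).deriv] at this

/-- The Hessian of a convex function is positive semidefinite. -/
lemma inner_hessian_nonneg (hc : ConvexOn ℝ Set.univ f) (hf : Differentiable ℝ f)
    (hg : Differentiable ℝ (gradient f)) (θ v : Param d) : 0 ≤ inner ℝ (hessian f θ v) v := by
  have h := hasDerivAt_inner_gradient_line hg θ v v 0
  have hm := h.hasDerivWithinAt.nonneg_of_monotoneOn (s := Set.univ)
    (by rw [accPt_principal_iff_nhdsWithin]; rw [← Set.compl_eq_univ_sdiff]; infer_instance)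
    ((monotone_inner_gradient_line hc hf θ v).monotoneOn _)
  simpa using hm

/-- The Hessian of a twice differentiable function is symmetric. -/
lemma inner_hessian_comm (hf : Differentiable ℝ f)
    (hg : Differentiable ℝ (gradient f)) (θ v w : Param d) :
    inner ℝ (hessian f θ v) w = inner ℝ (hessian f θ w) v := by
  have h1 : ∀ y, HasFDerivAt f (innerSL ℝ (gradient f y)) y :=
    fun y => (hf y).hasGradientAt.hasFDerivAt
  have h2 : HasFDerivAt (fun y => innerSL ℝ (gradient f y)) ((innerSL ℝ).comp (hessian f θ)) θ :=
    (innerSL ℝ).hasFDerivAt.comp θ (hg θ).hasFDerivAt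
  exact second_derivative_symmetric h1 h2 v w

/-- Growth of the gradient along a segment, from a lower bound of the curvature on an initial
piece of it. -/
lemma mul_le_inner_gradient_sub (hc : ConvexOn ℝ Set.univ f) (hf : Differentiable ℝ f)
    (hg : Differentiable ℝ (gradient f)) (a u : Param d) {κ s₀ : ℝ} (h₀ : 0 ≤ s₀) (h₁ : s₀ ≤ 1)
    (hκ : ∀ s ∈ Set.Icc 0 s₀, κ ≤ inner ℝ (hessian f (a + s • u) u) u) :
    κ * s₀ ≤ inner ℝ (gradient f (a + u) - gradient f a) u := by
  have hd := fun s => hasDerivAt_inner_gradient_line hg a u u s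
  -- The mean value inequality gains `κ * s₀` on the curved piece `[0, s₀]`; on `[s₀, 1]`
  -- monotonicity only ensures that nothing is lost.
  have h2 := (convex_Icc (0 : ℝ) s₀).mul_sub_le_image_sub_of_le_deriv
    (fun s _ => (hd s).continuousAt.continuousWithinAt)
    (fun s _ => (hd s).differentiableAt.differentiableWithinAt) (C := κ)
    (fun s hs => by
      rw [(hd s).deriv]
      exact hκ s (interior_subset hs))
    0 (Set.left_mem_Icc.2 h₀) s₀ (Set.right_mem_Icc.2 h₀) h₀
  have h3 := monotone_inner_gradient_line hc hf a u h₁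
  simp only [sub_zero, zero_smul, add_zero, one_smul] at h2 h3
  rw [inner_sub_left]
  linarith

/-- First-order condition along a segment for a minimizer of `f + K ‖·‖`. -/
lemma inner_gradient_le_of_le_add (hf : Differentiable ℝ f) (a u : Param d) {K : ℝ}
    (h : ∀ s ∈ Set.Icc (0 : ℝ) 1, f a ≤ f (a + s • u) + K * s) :
    -K ≤ inner ℝ (gradient f a) u := by
  have hd : HasDerivAt (fun s : ℝ => f (a + s • u) + K * s) (inner ℝ (gradient f a) u + K) 0 := by
    have h1 := hasDerivAt_comp_line hf a u 0
    rw [zero_smul, add_zero] at h1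
    exact h1.add (by simpa using (hasDerivAt_id (0 : ℝ)).const_mul K)
  have hmin : IsMinOn (fun s : ℝ => f (a + s • u) + K * s) (Set.Icc 0 1) 0 := by
    intro s hs
    simpa using h s hs
  -- The minimum is at the left endpoint of `[0, 1]`, so only the one-sided derivative, in the
  -- tangent direction `1`, is nonnegative.
  have := hmin.localize.hasFDerivWithinAt_nonneg hd.hasFDerivAt.hasFDerivWithinAt (y := 1)
    (by
      have := sub_mem_posTangentConeAt_of_segment_subset (x := (0 : ℝ)) (y := 1)
        (s := Set.Icc 0 1) (by rw [segment_eq_Icc zero_le_one])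
      simpa using this)
  simp only [ContinuousLinearMap.toSpanSingleton_apply, one_smul] at this
  linarith

/-- A convex function with small gradient at `θs` and curvature at least `ρ / 2` near `θs` has a
unique minimizer; approximate minimizers in the sense of an exact penalty are close to it. -/
theorem exists_minimizer_of_curvature (hc : ConvexOn ℝ Set.univ f) (hf : Differentiable ℝ f)
    (hg : Differentiable ℝ (gradient f)) {θs : Param d} {ρ M : ℝ} (hρ : 0 < ρ) (hM : 0 < M)
    (hH : ∀ θ ∈ Metric.ball θs M, ∀ v, ρ / 2 * ‖v‖ ^ 2 ≤ inner ℝ (hessian f θ v) v)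
    (hs : ‖gradient f θs‖ < ρ * M / 8) :
    ∃ θt : Param d, {θ | IsMinOn f Set.univ θ} = {θt} ∧
      ‖θt - θs‖ ≤ 2 / ρ * ‖gradient f θs‖ ∧
      ∀ lam : ℝ, 0 ≤ lam → lam < ρ * M / 4 → ∀ θ : Param d,
        (∀ θ', f θ ≤ f θ' + lam * ‖θ - θ'‖) → ‖θ - θt‖ ≤ 2 * lam / ρ := by
  -- Compactness gives a minimizer on a small ball. The distance bound then puts it in the interior,
  -- where a local minimum of a convex function is global.
  obtain ⟨θt, hmem, hmin⟩ := (isCompact_closedBall θs (M / 4)).exists_isMinOn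
    ⟨θs, Metric.mem_closedBall_self (by positivity)⟩ hf.continuous.continuousOn
  rw [mem_closedBall_iff_norm] at hmem
  have hdist : ‖θt - θs‖ ≤ 2 / ρ * ‖gradient f θs‖ := by
    have h1 := mul_le_inner_gradient_sub hc hf hg θs (θt - θs) zero_le_one le_rfl
      (κ := ρ / 2 * ‖θt - θs‖ ^ 2) (fun s hs => hH _ (by
        rw [mem_ball_iff_norm, add_sub_cancel_left, norm_smul, Real.norm_of_nonneg hs.1]
        nlinarith [hs.2, norm_nonneg (θt - θs)]) _)
    -- Moving from `θt` towards the centre stays in the ball, so the first-order condition applies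
    -- even if `θt` were on the boundary.
    have h2 := inner_gradient_le_of_le_add hf θt (-(θt - θs)) (K := 0) (fun s hs => by
      have := hmin (show θt + s • -(θt - θs) ∈ Metric.closedBall θs (M / 4) by
        rw [mem_closedBall_iff_norm,
          show θt + s • -(θt - θs) - θs = (1 - s) • (θt - θs) by module, norm_smul,
          Real.norm_of_nonneg (by linarith [hs.2])]
        nlinarith [hs.1, norm_nonneg (θt - θs)])
      simpa using this)
    rw [inner_neg_right] at h2
    rw [add_sub_cancel, inner_sub_left] at h1
    have h3 := abs_real_inner_le_norm (gradient f θs) (θt - θs)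
    have h4 := (abs_le.1 h3).1
    rcases (norm_nonneg (θt - θs)).eq_or_lt with h0 | h0
    · rw [← h0]; positivity
    · have h5 : ρ / 2 * ‖θt - θs‖ ≤ ‖gradient f θs‖ := by
        refine le_of_mul_le_mul_right ?_ h0
        nlinarith
      rw [div_mul_eq_mul_div, le_div_iff₀ hρ]
      linarith
  have hlt : ‖θt - θs‖ < M / 4 := by
    refine hdist.trans_lt ?_
    rw [div_mul_eq_mul_div, div_lt_iff₀ hρ]
    linarith
  have hglob : IsMinOn f Set.univ θt := by
    refine fun θ _ => IsMinOn.of_isLocalMin_of_convex_univ (hmin.isLocalMin ?_) hc θ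
    exact Metric.closedBall_mem_nhds_of_mem (by rwa [mem_ball_iff_norm])
  have hpen : ∀ lam : ℝ, 0 ≤ lam → lam < ρ * M / 4 → ∀ θ : Param d,
        (∀ θ', f θ ≤ f θ' + lam * ‖θ - θ'‖) → ‖θ - θt‖ ≤ 2 * lam / ρ := by
    intro lam hlam₀ hlam θ hθ
    have hgrad : gradient f θt = 0 := by
      have h := (hglob.isLocalMin Filter.univ_mem).fderiv_eq_zero
      simp [gradient, h]
    have h2 := inner_gradient_le_of_le_add hf θ (-(θ - θt)) (K := lam * ‖θ - θt‖) (fun s hs => by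
      have := hθ (θ + s • -(θ - θt))
      rwa [show θ - (θ + s • -(θ - θt)) = s • (θ - θt) by module, norm_smul,
        Real.norm_of_nonneg hs.1, mul_comm s, ← mul_assoc] at this)
    rw [inner_neg_right] at h2
    rcases (norm_nonneg (θ - θt)).eq_or_lt with h0 | h0
    · rw [← h0]
      positivity
    set R := ‖θ - θt‖ with hR
    -- The segment from `θt` is cut at length `M / 2`: as `θt` is within `M / 4` of `θs`, this piece
    -- remains in the region of curvature.
    have h1 := mul_le_inner_gradient_sub hc hf hg θt (θ - θt) (s₀ := min 1 (M / 2 / R))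
      (by positivity) (min_le_left _ _)
      (κ := ρ / 2 * R ^ 2) (fun s hs => hH _ (by
        rw [mem_ball_iff_norm, show θt + s • (θ - θt) - θs = (θt - θs) + s • (θ - θt) by module]
        refine (norm_add_le _ _).trans_lt ?_
        rw [norm_smul, Real.norm_of_nonneg hs.1]
        have h6 := hs.2.trans (min_le_right _ _)
        rw [le_div_iff₀ h0] at h6
        linarith) _)
    rw [add_sub_cancel, hgrad, sub_zero] at h1
    have h7 : ρ / 2 * min R (M / 2) ≤ lam := by
      refine le_of_mul_le_mul_right ?_ h0
      have : min R (M / 2) = R * min 1 (M / 2 / R) := by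
        rw [mul_min_of_nonneg _ _ h0.le, mul_one, mul_div_cancel₀ _ h0.ne']
      rw [this]
      nlinarith
    rcases le_total R (M / 2) with h8 | h8
    · rw [min_eq_left h8] at h7
      rw [le_div_iff₀ hρ]
      linarith
    · rw [min_eq_right h8] at h7
      linarith
  refine ⟨θt, ?_, hdist, hpen⟩
  ext θ
  refine ⟨fun h => ?_, fun h => h ▸ hglob⟩
  -- Uniqueness is the stability bound with penalty zero.
  have := hpen 0 le_rfl (by positivity) θ (fun θ' => by simpa using h (Set.mem_univ θ'))
  simpa [sub_eq_zero] using this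

end Deterministic

/-! ### Nets in Euclidean balls -/

section Nets

variable {d : ℕ}

/-- Every subset of a ball of radius `r` in `ℝ^d` has an `r / 2`-net with at most `5 ^ d` points. -/
lemma exists_half_net (A : Set (Param d)) (c : Param d) {r : ℝ} (hr : 0 < r)
    (hA : A ⊆ Metric.closedBall c r) :
    ∃ T : Finset (Param d), (T : Set (Param d)) ⊆ A ∧ T.card ≤ 5 ^ d ∧
      ∀ x ∈ A, ∃ y ∈ T, ‖x - y‖ ≤ r / 2 := by
  classical
  let p : ℕ → Prop := fun k => ∃ T : Finset (Param d), (T : Set (Param d)) ⊆ A ∧ T.card = k ∧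
    ∀ x ∈ T, ∀ y ∈ T, x ≠ y → r / 2 < ‖x - y‖
  have hbd : ∀ k, p k → k ≤ 5 ^ d := by
    rintro k ⟨T, hTA, rfl, hT⟩
    have hinj : Function.Injective (fun x : Param d => (2 / r) • (x - c)) := by
      intro x y hxy
      simpa [hr.ne'] using hxy
    -- After scaling by `2 / r` the points are `1`-separated in a ball of radius `2`, where a volume
    -- count allows at most `5 ^ d` of them.
    have h := Besicovitch.card_le_of_separated (T.image (fun x : Param d => (2 / r) • (x - c)))
      (by
        simp only [Finset.mem_image, forall_exists_index, and_imp, forall_apply_eq_imp_iff₂]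
        intro x hx
        have := mem_closedBall_iff_norm.1 (hA (hTA hx))
        rw [norm_smul, Real.norm_of_nonneg (by positivity), div_mul_eq_mul_div, div_le_iff₀ hr]
        linarith)
      (by
        simp only [Finset.mem_image, forall_exists_index, and_imp, forall_apply_eq_imp_iff₂]
        intro x hx y hy hxy
        have := hT x hx y hy (fun h => hxy (by rw [h]))
        rw [← smul_sub, sub_sub_sub_cancel_right, norm_smul, Real.norm_of_nonneg (by positivity),
          div_mul_eq_mul_div, le_div_iff₀ hr]
        linarith)
    rwa [Finset.card_image_of_injective _ hinj, finrank_euclideanSpace_fin] at h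
  have h0 : p 0 := ⟨∅, by simp, rfl, by simp⟩
  -- A separated set of maximal cardinality is a net: an uncovered point could be added.
  obtain ⟨T, hTA, hcard, hT⟩ := Nat.findGreatest_spec (P := p) (n := 5 ^ d) (Nat.zero_le _) h0
  refine ⟨T, hTA, hcard ▸ Nat.findGreatest_le _, fun x hx => ?_⟩
  by_contra! hfar
  have hxT : x ∉ T := fun h => by
    have := hfar x h
    rw [sub_self, norm_zero] at this
    linarith
  have hp : p (T.card + 1) := by
    refine ⟨insert x T, ?_, Finset.card_insert_of_notMem hxT, ?_⟩
    · rw [Finset.coe_insert]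
      exact Set.insert_subset hx hTA
    · intro y hy z hz hyz
      rcases Finset.mem_insert.1 hy with rfl | hy' <;> rcases Finset.mem_insert.1 hz with rfl | hz'
      · exact absurd rfl hyz
      · exact hfar z hz'
      · rw [norm_sub_rev]
        exact hfar y hy'
      · exact hT y hy' z hz' hyz
  have := Nat.le_findGreatest (hbd _ hp) hp
  omega

/-- Every subset of a ball of radius `r` in `ℝ^d` has a `2 r / 2 ^ k`-net with at most `5 ^ (d k)`
points. -/
lemma exists_dyadic_net (k : ℕ) (A : Set (Param d)) (c : Param d) {r : ℝ} (hr : 0 < r)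
    (hA : A ⊆ Metric.closedBall c r) :
    ∃ T : Finset (Param d), (T : Set (Param d)) ⊆ A ∧ T.card ≤ 5 ^ (d * k) ∧
      ∀ x ∈ A, ∃ y ∈ T, ‖x - y‖ ≤ 2 * r / 2 ^ k := by
  classical
  induction k generalizing A c r with
  | zero =>
    rcases A.eq_empty_or_nonempty with rfl | ⟨a, ha⟩
    · exact ⟨∅, by simp, by simp, by simp⟩
    · refine ⟨{a}, by simpa using ha, by simp, fun x hx => ⟨a, by simp, ?_⟩⟩
      have h1 := mem_closedBall_iff_norm.1 (hA hx)
      have h2 := mem_closedBall_iff_norm.1 (hA ha)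
      rw [show x - a = (x - c) - (a - c) by abel]
      refine (norm_sub_le _ _).trans ?_
      simp only [pow_zero, div_one]
      linarith
  | succ k ih =>
    obtain ⟨T, hTA, hcard, hT⟩ := exists_half_net A c hr hA
    -- Intersecting with `A` keeps all net points inside `A`; the net for the Hessian must lie where
    -- the curvature bounds hold.
    choose U hUA hUcard hU using fun y : Param d =>
      ih (A ∩ Metric.closedBall y (r / 2)) y (half_pos hr) Set.inter_subset_right
    refine ⟨T.biUnion U, ?_, ?_, ?_⟩
    · intro x hx
      obtain ⟨y, -, hxy⟩ := Finset.mem_biUnion.1 hx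
      exact (hUA y hxy).1
    · refine (Finset.card_biUnion_le_card_mul _ _ _ fun y _ => hUcard y).trans ?_
      rw [show d * (k + 1) = d + d * k by ring, pow_add]
      exact Nat.mul_le_mul_right _ hcard
    · intro x hx
      obtain ⟨y, hy, hxy⟩ := hT x hx
      obtain ⟨z, hz, hxz⟩ := hU y x ⟨hx, mem_closedBall_iff_norm.2 hxy⟩
      refine ⟨z, Finset.mem_biUnion.2 ⟨y, hy, hz⟩, hxz.trans (le_of_eq ?_)⟩
      rw [pow_succ]
      field_simp

/-- Every subset of a ball of radius `r` in `ℝ^d` has a `δ`-net with at most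
`exp (d (6 + 3 log (r / δ)))` points. -/
lemma exists_net (A : Set (Param d)) (c : Param d) {r δ : ℝ} (hδ : 0 < δ) (hr : δ ≤ r)
    (hA : A ⊆ Metric.closedBall c r) :
    ∃ T : Finset (Param d), (T : Set (Param d)) ⊆ A ∧
      (T.card : ℝ) ≤ Real.exp (d * (6 + 3 * Real.log (r / δ))) ∧
      ∀ x ∈ A, ∃ y ∈ T, ‖x - y‖ ≤ δ := by
  have hr0 : 0 < r := hδ.trans_le hr
  have hrδ : 1 ≤ r / δ := (one_le_div hδ).2 hr
  -- The least number of halvings that brings `2 * r` down to `δ`. The entropy bound then follows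
  -- from `log 5 ≤ 2` and `1 / log 2 ≤ 3 / 2`.
  set k := ⌈Real.logb 2 (2 * (r / δ))⌉₊ with hk
  obtain ⟨T, hTA, hcard, hT⟩ := exists_dyadic_net k A c hr0 hA
  have hlog5 : Real.log 5 ≤ 2 := by
    rw [Real.log_le_iff_le_exp (by norm_num)]
    have h := Real.exp_one_gt_d9
    have : Real.exp 2 = Real.exp 1 * Real.exp 1 := by rw [← Real.exp_add]; norm_num
    nlinarith
  have hlog2 := Real.log_two_gt_d9
  have hlogb : 0 ≤ Real.logb 2 (2 * (r / δ)) :=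
    Real.logb_nonneg (by norm_num) (by linarith)
  have hk1 : (k : ℝ) ≤ 2 + 3 / 2 * Real.log (r / δ) := by
    have h1 := (Nat.ceil_lt_add_one hlogb).le
    rw [Real.logb, Real.log_mul (by norm_num) (by positivity), add_div,
      div_self (by positivity)] at h1
    have h2 : Real.log (r / δ) / Real.log 2 ≤ 3 / 2 * Real.log (r / δ) := by
      rw [div_le_iff₀ (by positivity)]
      nlinarith [Real.log_nonneg hrδ]
    rw [hk, Real.logb, Real.log_mul (by norm_num) (by positivity), add_div,
      div_self (by positivity)]
    linarith
  refine ⟨T, hTA, ?_, fun x hx => ?_⟩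
  · calc (T.card : ℝ) ≤ (5 : ℝ) ^ (d * k) := by exact_mod_cast hcard
      _ = Real.exp (d * k * Real.log 5) := by
        rw [← Nat.cast_mul, Real.exp_nat_mul, Real.exp_log (by norm_num)]
      _ ≤ _ := by
        refine Real.exp_le_exp.2 ?_
        rw [mul_assoc]
        refine mul_le_mul_of_nonneg_left ?_ (Nat.cast_nonneg _)
        have := Real.log_nonneg hrδ
        have h5 : 0 ≤ Real.log 5 := Real.log_nonneg (by norm_num)
        nlinarith
  · obtain ⟨y, hy, hxy⟩ := hT x hx
    refine ⟨y, hy, hxy.trans ?_⟩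
    have h1 : Real.logb 2 (2 * (r / δ)) ≤ k := Nat.le_ceil _
    rw [Real.logb_le_iff_le_rpow (by norm_num) (by positivity), Real.rpow_natCast] at h1
    rw [div_le_iff₀ (by positivity)]
    calc 2 * r = δ * (2 * (r / δ)) := by field_simp
      _ ≤ _ := mul_le_mul_of_nonneg_left h1 hδ.le

end Nets

/-! ### Tail bounds for i.i.d. sums -/

section Chernoff

variable {S Ω : Type*} [MeasurableSpace S] [MeasurableSpace Ω] {P : Measure S} {μ : Measure Ω}
  [IsProbabilityMeasure μ] {N : ℕ} {ξ : Fin N → Ω → S}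

/-- Chernoff bound for the sum of a function of an i.i.d. sample. -/
lemma measure_sum_ge_le_exp (hlaw : ∀ i, HasLaw (ξ i) P μ) (hind : iIndepFun ξ μ) {X : S → ℝ}
    (hX : Measurable X) {s a b : ℝ} (hs : 0 ≤ s) (hint : Integrable (fun x => Real.exp (s * X x)) P)
    (hmgf : ∫ x, Real.exp (s * X x) ∂P ≤ Real.exp b) :
    μ {ω | N * a ≤ ∑ i, X (ξ i ω)} ≤ ENNReal.ofReal (Real.exp (-(N * (s * a - b)))) := by
  have hind' : iIndepFun (fun i ω => X (ξ i ω)) μ := hind.comp (fun _ => X) fun _ => hX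
  have hmeas : ∀ i, AEMeasurable (fun ω => X (ξ i ω)) μ :=
    fun i => hX.comp_aemeasurable (hlaw i).aemeasurable
  have hmg : ∀ i, mgf (fun ω => X (ξ i ω)) μ s = ∫ x, Real.exp (s * X x) ∂P := fun i =>
    (hlaw i).integral_comp (f := fun x => Real.exp (s * X x)) (by fun_prop)
  have hi : ∀ i, Integrable (fun ω => Real.exp (s * X (ξ i ω))) μ := fun i => by
    have := (hlaw i).map_eq ▸ hint
    exact this.comp_aemeasurable (hlaw i).aemeasurable
  have hsum : Integrable (fun ω => Real.exp (s * ∑ i, X (ξ i ω))) μ := by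
    -- The sample is only almost everywhere measurable, so integrability of the product is proved
    -- for measurable versions and transferred back.
    have hmk : ∀ i, (fun ω => X (ξ i ω)) =ᵐ[μ] (hmeas i).mk _ := fun i => (hmeas i).ae_eq_mk
    have h := (hind'.congr hmk).integrable_exp_mul_sum (fun i => (hmeas i).measurable_mk)
      (t := s) (s := Finset.univ) fun i _ => (hi i).congr (by
        filter_upwards [hmk i] with ω hω
        rw [hω])
    refine h.congr ?_
    filter_upwards [ae_all_iff.2 hmk] with ω hω
    simp only [Finset.sum_apply, hω]
  have h := measure_ge_le_exp_mul_mgf (μ := μ) (X := ∑ i, fun ω => X (ξ i ω)) (N * a) hs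
    (by simpa using hsum)
  rw [hind'.mgf_sum₀ hmeas] at h
  simp only [hmg, Finset.prod_const, Finset.card_univ, Fintype.card_fin, Finset.sum_apply] at h
  have h2 : μ.real {ω | N * a ≤ ∑ i, X (ξ i ω)} ≤ Real.exp (-(N * (s * a - b))) := by
    refine h.trans ?_
    have h3 : (∫ x, Real.exp (s * X x) ∂P) ^ N ≤ Real.exp b ^ N :=
      pow_le_pow_left₀ (integral_nonneg fun x => (Real.exp_pos _).le) hmgf N
    refine (mul_le_mul_of_nonneg_left h3 (Real.exp_pos _).le).trans (le_of_eq ?_)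
    rw [← Real.exp_nat_mul, ← Real.exp_add]
    congr 1
    ring
  rw [measureReal_def] at h2
  exact (ENNReal.le_ofReal_iff_toReal_le (measure_ne_top _ _) (Real.exp_pos _).le).2 h2

/-- Markov's inequality for the sum of a function of an i.i.d. sample. -/
lemma measure_sum_ge_le_div (hlaw : ∀ i, HasLaw (ξ i) P μ) {G : S → ℝ} (hG : Integrable G P)
    (hG0 : ∀ᵐ x ∂P, 0 ≤ G x) {R : ℝ} (hR : 0 < R) (hN : 0 < N) :
    μ {ω | N * R ≤ ∑ i, G (ξ i ω)} ≤ ENNReal.ofReal ((∫ x, G x ∂P) / R) := by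
  have hi : ∀ i, Integrable (fun ω => G (ξ i ω)) μ := fun i => by
    have := (hlaw i).map_eq ▸ hG
    exact this.comp_aemeasurable (hlaw i).aemeasurable
  have hnn : ∀ i, ∀ᵐ ω ∂μ, 0 ≤ G (ξ i ω) := fun i => by
    have := (hlaw i).map_eq.symm ▸ hG0
    exact ae_of_ae_map (hlaw i).aemeasurable this
  have hnn' : 0 ≤ᵐ[μ] fun ω => ∑ i, G (ξ i ω) := by
    filter_upwards [ae_all_iff.2 hnn] with ω hω using Finset.sum_nonneg fun i _ => hω i
  have h := mul_meas_ge_le_integral_of_nonneg hnn' (integrable_finsetSum _ fun i _ => hi i) (N * R)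
  rw [integral_finsetSum _ fun i _ => hi i] at h
  have he : ∀ i, ∫ ω, G (ξ i ω) ∂μ = ∫ x, G x ∂P := fun i =>
    (hlaw i).integral_comp hG.aestronglyMeasurable
  simp only [he, Finset.sum_const, Finset.card_univ, Fintype.card_fin, nsmul_eq_mul] at h
  have hN' : (0 : ℝ) < N := by exact_mod_cast hN
  have h2 : μ.real {ω | N * R ≤ ∑ i, G (ξ i ω)} ≤ (∫ x, G x ∂P) / R := by
    rw [le_div_iff₀ hR]
    refine le_of_mul_le_mul_left ?_ hN'
    linarith
  rw [measureReal_def] at h2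
  exact (ENNReal.le_ofReal_iff_toReal_le (measure_ne_top _ _)
    (div_nonneg (integral_nonneg_of_ae hG0) hR.le)).2 h2

end Chernoff

/-! ### Moment generating functions from moment bounds -/

section Moments

/-- Since `exp y ≥ 1 + y + y ^ 2 / 2`, it is enough that the product of this polynomial with the
right-hand side is `1 + y ^ 4 / 4 ≥ 1`. -/
lemma exp_neg_le_quadratic {y : ℝ} (hy : 0 ≤ y) : Real.exp (-y) ≤ 1 - y + y ^ 2 / 2 := by
  have h1 := Real.quadratic_le_exp_of_nonneg hy
  rw [Real.exp_neg, inv_le_iff_one_le_mul₀ (Real.exp_pos _)]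
  have h2 : 0 ≤ 1 - y + y ^ 2 / 2 := by nlinarith [sq_nonneg (y - 1)]
  refine le_trans ?_ (mul_le_mul_of_nonneg_left h1 h2)
  nlinarith [sq_nonneg (y ^ 2)]

/-- The linear term integrates to zero for a centred variable, which leaves the exponential of its
square, accessible through even moments. -/
lemma exp_le_add_exp_sq (x : ℝ) : Real.exp x ≤ x + Real.exp (x ^ 2) := by
  have h2 := Real.add_one_le_exp (x ^ 2)
  rcases le_or_gt |x| 1 with h | h
  · have h1 := (abs_le.1 (Real.abs_exp_sub_one_sub_id_le h)).2
    linarith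
  · rcases lt_abs.1 h with h | h
    · have : Real.exp x ≤ Real.exp (x ^ 2) := Real.exp_le_exp.2 (by nlinarith)
      linarith
    · have : Real.exp x ≤ 1 := Real.exp_le_one_iff.2 (by linarith)
      nlinarith

variable {S : Type*} [MeasurableSpace S] {P : Measure S}

lemma eLpNorm_le_of_psiTwoNorm_le {X : S → ℝ} {c : ℝ} (h : psiTwoNorm P X ≤ ENNReal.ofReal c) {q : ℝ} (hq : 1 ≤ q) :
    eLpNorm X (ENNReal.ofReal q) P ≤ ENNReal.ofReal (c * Real.sqrt q) := by
  have h1 : ENNReal.ofReal (q ^ (-(1 / 2) : ℝ)) * eLpNorm X (ENNReal.ofReal q) P ≤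
      ENNReal.ofReal c := le_trans (le_iSup₂_of_le q hq le_rfl) h
  have hq0 : 0 < q := by linarith
  have h2 : ENNReal.ofReal (Real.sqrt q) * ENNReal.ofReal (q ^ (-(1 / 2) : ℝ)) = 1 := by
    rw [← ENNReal.ofReal_mul (Real.sqrt_nonneg _), Real.sqrt_eq_rpow, ← Real.rpow_add hq0]
    simp
  calc eLpNorm X (ENNReal.ofReal q) P
      = ENNReal.ofReal (Real.sqrt q) *
        (ENNReal.ofReal (q ^ (-(1 / 2) : ℝ)) * eLpNorm X (ENNReal.ofReal q) P) := by
        rw [← mul_assoc, h2, one_mul]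
    _ ≤ ENNReal.ofReal (Real.sqrt q) * ENNReal.ofReal c := by gcongr
    _ = _ := by rw [← ENNReal.ofReal_mul (Real.sqrt_nonneg _), mul_comm]

lemma eLpNorm_le_of_psiOneNorm_le {X : S → ℝ} {c : ℝ} (h : psiOneNorm P X ≤ ENNReal.ofReal c) {q : ℝ} (hq : 1 ≤ q) :
    eLpNorm X (ENNReal.ofReal q) P ≤ ENNReal.ofReal (c * q) := by
  have h1 : ENNReal.ofReal (q ^ (-1 : ℝ)) * eLpNorm X (ENNReal.ofReal q) P ≤
      ENNReal.ofReal c := le_trans (le_iSup₂_of_le q hq le_rfl) h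
  have hq0 : 0 < q := by linarith
  have h2 : ENNReal.ofReal q * ENNReal.ofReal (q ^ (-1 : ℝ)) = 1 := by
    rw [← ENNReal.ofReal_mul hq0.le, Real.rpow_neg_one, mul_inv_cancel₀ hq0.ne']
    simp
  calc eLpNorm X (ENNReal.ofReal q) P
      = ENNReal.ofReal q *
        (ENNReal.ofReal (q ^ (-1 : ℝ)) * eLpNorm X (ENNReal.ofReal q) P) := by
        rw [← mul_assoc, h2, one_mul]
    _ ≤ ENNReal.ofReal q * ENNReal.ofReal c := by gcongr
    _ = _ := by rw [← ENNReal.ofReal_mul hq0.le, mul_comm]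

lemma integrable_of_psiTwoNorm_le {X : S → ℝ} (hX : Measurable X) {c : ℝ}
    (h : psiTwoNorm P X ≤ ENNReal.ofReal c) : Integrable X P := by
  rw [← memLp_one_iff_integrable]
  refine ⟨hX.aestronglyMeasurable, ?_⟩
  have := eLpNorm_le_of_psiTwoNorm_le h le_rfl
  rw [ENNReal.ofReal_one] at this
  exact this.trans_lt ENNReal.ofReal_lt_top

variable [IsProbabilityMeasure P]

lemma integrable_exp_neg_of_nonneg {Y : S → ℝ} (hY : Measurable Y) (hY0 : ∀ x, 0 ≤ Y x) {s : ℝ}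
    (hs : 0 ≤ s) : Integrable (fun x => Real.exp (s * -Y x)) P := by
  refine (integrable_const (1 : ℝ)).mono' (by fun_prop) (Filter.Eventually.of_forall fun x => ?_)
  rw [Real.norm_of_nonneg (Real.exp_pos _).le]
  exact Real.exp_le_one_iff.2 (by nlinarith [hY0 x, mul_nonneg hs (hY0 x)])

/-- The lower tail of a nonnegative variable is controlled by its second moment. -/
lemma integral_exp_neg_le {Y : S → ℝ} (hY : Measurable Y) (hY0 : ∀ x, 0 ≤ Y x) (hL : MemLp Y 2 P)
    {s : ℝ} (hs : 0 ≤ s) :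
    ∫ x, Real.exp (s * -Y x) ∂P ≤
      Real.exp (-(s * ∫ x, Y x ∂P) + s ^ 2 / 2 * ∫ x, Y x ^ 2 ∂P) := by
  have h1 : Integrable Y P := hL.integrable (by norm_num)
  have h2 : Integrable (fun x => Y x ^ 2) P := hL.integrable_sq
  calc ∫ x, Real.exp (s * -Y x) ∂P
      ≤ ∫ x, (1 - s * Y x + s ^ 2 / 2 * Y x ^ 2) ∂P := by
        refine integral_mono (integrable_exp_neg_of_nonneg hY hY0 hs)
          (((integrable_const _).sub (h1.const_mul _)).add (h2.const_mul _)) fun x => ?_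
        have := exp_neg_le_quadratic (mul_nonneg hs (hY0 x))
        simp only [mul_neg]
        refine this.trans (le_of_eq (by ring))
    _ = 1 - s * ∫ x, Y x ∂P + s ^ 2 / 2 * ∫ x, Y x ^ 2 ∂P := by
        have h3 : Integrable (fun x => 1 - s * Y x) P := (integrable_const _).sub (h1.const_mul _)
        rw [integral_add h3 (h2.const_mul _), integral_sub (integrable_const _) (h1.const_mul _),
          integral_const_mul, integral_const_mul]
        simp
    _ ≤ _ := by
        refine le_trans (le_of_eq ?_) (Real.add_one_le_exp _)
        ring

/-- From `k ^ k / k! ≤ exp k` and `exp 1 ≤ 3`; it makes the series of even moments geometric. -/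
lemma two_mul_pow_div_factorial_le (k : ℕ) : (2 * k : ℝ) ^ k / k.factorial ≤ 6 ^ k := by
  have h1 := Real.pow_div_factorial_le_exp (x := (k : ℝ)) (Nat.cast_nonneg _) k
  have h2 : Real.exp k ≤ 3 ^ k := by
    rw [← mul_one (k : ℝ), Real.exp_nat_mul]
    exact pow_le_pow_left₀ (Real.exp_pos _).le (by linarith [Real.exp_one_lt_d9]) _
  rw [mul_pow, mul_div_assoc]
  calc (2 : ℝ) ^ k * ((k : ℝ) ^ k / k.factorial) ≤ 2 ^ k * 3 ^ k := by gcongr; exact h1.trans h2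
    _ = 6 ^ k := by rw [← mul_pow]; norm_num

lemma lintegral_even_moment_le {X : S → ℝ} {c : ℝ} (hc : 0 ≤ c)
    (h : psiTwoNorm P X ≤ ENNReal.ofReal c) (k : ℕ) :
    ∫⁻ x, ENNReal.ofReal ((X x ^ 2) ^ k) ∂P ≤ ENNReal.ofReal ((c ^ 2 * (2 * k)) ^ k) := by
  rcases Nat.eq_zero_or_pos k with rfl | hk
  · simp
  have hk1 : (1 : ℝ) ≤ 2 * k := by
    have : (1 : ℝ) ≤ k := by exact_mod_cast hk
    linarith
  have h1 := eLpNorm_le_of_psiTwoNorm_le h hk1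
  have hq : ENNReal.ofReal (2 * k) = ((2 * k : ℕ) : NNReal) := by
    rw [ENNReal.ofReal]
    congr 1
    exact NNReal.eq (by simp)
  rw [hq] at h1
  have h2 := eLpNorm_nnreal_pow_eq_lintegral (f := X) (μ := P) (p := ((2 * k : ℕ) : NNReal))
    (by simpa using hk.ne')
  calc ∫⁻ x, ENNReal.ofReal ((X x ^ 2) ^ k) ∂P
      = ∫⁻ x, ‖X x‖ₑ ^ (((2 * k : ℕ) : NNReal) : ℝ) ∂P := by
        refine lintegral_congr fun x => ?_
        rw [NNReal.coe_natCast, ENNReal.rpow_natCast, pow_mul, Real.enorm_eq_ofReal_abs,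
          ← ENNReal.ofReal_pow (abs_nonneg _), sq_abs, ENNReal.ofReal_pow (sq_nonneg _)]
    _ = eLpNorm X ((2 * k : ℕ) : NNReal) P ^ (2 * k) := by
        rw [← h2, NNReal.coe_natCast, ENNReal.rpow_natCast]
    _ ≤ ENNReal.ofReal (c * Real.sqrt (2 * k)) ^ (2 * k) := by gcongr
    _ = _ := by
        rw [pow_mul, ← ENNReal.ofReal_pow (by positivity), mul_pow,
          Real.sq_sqrt (by positivity), ENNReal.ofReal_pow (by positivity)]

/-- Termwise integration of the exponential series gives at most the geometric series of ratio `y =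
6 * c ^ 2 * s ^ 2`, and `1 / (1 - y) ≤ 1 + 2 * y ≤ exp (2 * y)` for `y ≤ 1 / 2`. -/
lemma lintegral_exp_sq_le {X : S → ℝ} (hX : Measurable X) {c : ℝ} (hc : 0 ≤ c)
    (h : psiTwoNorm P X ≤ ENNReal.ofReal c) {s : ℝ} (hs : 12 * c ^ 2 * s ^ 2 ≤ 1) :
    ∫⁻ x, ENNReal.ofReal (Real.exp ((s * X x) ^ 2)) ∂P ≤
      ENNReal.ofReal (Real.exp (12 * c ^ 2 * s ^ 2)) := by
  set y := 6 * c ^ 2 * s ^ 2 with hy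
  have hy0 : 0 ≤ y := by positivity
  have hy1 : y ≤ 1 / 2 := by linarith
  have hexp : ∀ x, ENNReal.ofReal (Real.exp ((s * X x) ^ 2)) =
      ∑' k : ℕ, ENNReal.ofReal (((s * X x) ^ 2) ^ k / k.factorial) := fun x => by
    rw [← ENNReal.ofReal_tsum_of_nonneg (fun k => by positivity)
      (Real.summable_pow_div_factorial _), Real.exp_eq_exp_ℝ, NormedSpace.exp_eq_tsum_div]
  simp only [hexp]
  rw [lintegral_tsum fun k => by fun_prop]
  have hterm : ∀ k : ℕ, ∫⁻ x, ENNReal.ofReal (((s * X x) ^ 2) ^ k / k.factorial) ∂P ≤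
      ENNReal.ofReal (y ^ k) := fun k => by
    have he : ∀ x, ENNReal.ofReal (((s * X x) ^ 2) ^ k / k.factorial) =
        ENNReal.ofReal ((s ^ 2) ^ k / k.factorial) * ENNReal.ofReal ((X x ^ 2) ^ k) := fun x => by
      rw [← ENNReal.ofReal_mul (by positivity)]
      congr 1
      ring
    simp only [he]
    rw [lintegral_const_mul _ (by fun_prop)]
    refine (mul_le_mul_right (lintegral_even_moment_le hc h k) _).trans ?_
    rw [← ENNReal.ofReal_mul (by positivity)]
    refine ENNReal.ofReal_le_ofReal ?_
    calc (s ^ 2) ^ k / k.factorial * (c ^ 2 * (2 * k)) ^ k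
        = (c ^ 2 * s ^ 2) ^ k * ((2 * k : ℝ) ^ k / k.factorial) := by rw [mul_pow, mul_pow]; ring
      _ ≤ (c ^ 2 * s ^ 2) ^ k * 6 ^ k := by gcongr; exact two_mul_pow_div_factorial_le k
      _ = y ^ k := by rw [← mul_pow, hy]; ring
  refine (ENNReal.tsum_le_tsum hterm).trans ?_
  rw [← ENNReal.ofReal_tsum_of_nonneg (fun k => by positivity)
    (summable_geometric_of_lt_one hy0 (by linarith)), tsum_geometric_of_lt_one hy0 (by linarith)]
  refine ENNReal.ofReal_le_ofReal ?_
  have h1 := Real.add_one_le_exp (2 * y)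
  rw [show 12 * c ^ 2 * s ^ 2 = 2 * y by rw [hy]; ring]
  rw [inv_le_iff_one_le_mul₀ (by linarith)]
  nlinarith

lemma integrable_exp_sq {X : S → ℝ} (hX : Measurable X) {c : ℝ} (hc : 0 ≤ c)
    (h : psiTwoNorm P X ≤ ENNReal.ofReal c) {s : ℝ} (hs : 12 * c ^ 2 * s ^ 2 ≤ 1) :
    Integrable (fun x => Real.exp ((s * X x) ^ 2)) P :=
  (lintegral_ofReal_ne_top_iff_integrable (by fun_prop)
    (Filter.Eventually.of_forall fun x => (Real.exp_pos _).le)).1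
    ((lintegral_exp_sq_le hX hc h hs).trans_lt ENNReal.ofReal_lt_top).ne

lemma integrable_exp_of_psiTwoNorm_le {X : S → ℝ} (hX : Measurable X) {c : ℝ} (hc : 0 ≤ c)
    (h : psiTwoNorm P X ≤ ENNReal.ofReal c) {s : ℝ} (hs : 12 * c ^ 2 * s ^ 2 ≤ 1) :
    Integrable (fun x => Real.exp (s * X x)) P := by
  refine (((integrable_of_psiTwoNorm_le hX h).const_mul s).add
    (integrable_exp_sq hX hc h hs)).mono' (by fun_prop) (Filter.Eventually.of_forall fun x => ?_)
  rw [Real.norm_of_nonneg (Real.exp_pos _).le]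
  exact exp_le_add_exp_sq _

/-- Moment generating function of a centred sub-Gaussian variable, near the origin. -/
lemma integral_exp_le_of_psiTwoNorm_le {X : S → ℝ} (hX : Measurable X) {c : ℝ} (hc : 0 ≤ c)
    (h : psiTwoNorm P X ≤ ENNReal.ofReal c) (h0 : ∫ x, X x ∂P = 0) {s : ℝ}
    (hs : 12 * c ^ 2 * s ^ 2 ≤ 1) :
    ∫ x, Real.exp (s * X x) ∂P ≤ Real.exp (12 * c ^ 2 * s ^ 2) := by
  have hi := (integrable_of_psiTwoNorm_le hX h).const_mul s
  have hi2 := integrable_exp_sq hX hc h hs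
  calc ∫ x, Real.exp (s * X x) ∂P ≤ ∫ x, (s * X x + Real.exp ((s * X x) ^ 2)) ∂P :=
        integral_mono (integrable_exp_of_psiTwoNorm_le hX hc h hs) (hi.add hi2)
          fun x => exp_le_add_exp_sq _
    _ = ∫ x, Real.exp ((s * X x) ^ 2) ∂P := by
        rw [integral_add hi hi2, integral_const_mul, h0, mul_zero, zero_add]
    _ ≤ _ := by
        rw [integral_eq_lintegral_of_nonneg_ae
          (Filter.Eventually.of_forall fun x => (Real.exp_pos _).le) (by fun_prop)]
        exact ENNReal.toReal_le_of_le_ofReal (Real.exp_pos _).le (lintegral_exp_sq_le hX hc h hs)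

end Moments

/-! ### Reduction of vectors and operators to coordinates -/

section Coordinates

variable {d : ℕ}

/-- The matrix unit `e_j ⊗ e_i`. -/
noncomputable def matrixUnit (i j : Fin d) : Param d →L[ℝ] Param d :=
  (innerSL ℝ (EuclideanSpace.basisFun (Fin d) ℝ i)).smulRight (EuclideanSpace.basisFun (Fin d) ℝ j)

lemma norm_matrixUnit_le (i j : Fin d) : ‖matrixUnit i j‖ ≤ 1 := by
  rw [matrixUnit, ContinuousLinearMap.norm_smulRight_apply, innerSL_apply_norm]
  simp

/-- The entry `⟨T e_i, e_j⟩` of an operator. -/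
noncomputable def entry (T : Param d →L[ℝ] Param d) (i j : Fin d) : ℝ :=
  inner ℝ (T (EuclideanSpace.basisFun (Fin d) ℝ i)) (EuclideanSpace.basisFun (Fin d) ℝ j)

lemma eq_sum_entry_smul_matrixUnit (T : Param d →L[ℝ] Param d) :
    T = ∑ i, ∑ j, entry T i j • matrixUnit i j := by
  ext1 v
  conv_lhs => rw [← (EuclideanSpace.basisFun (Fin d) ℝ).sum_repr' v]
  rw [map_sum, sum_apply]
  refine Finset.sum_congr rfl fun i _ => ?_
  rw [map_smul, sum_apply,
    ← (EuclideanSpace.basisFun (Fin d) ℝ).sum_repr' (T (EuclideanSpace.basisFun (Fin d) ℝ i)),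
    Finset.smul_sum]
  refine Finset.sum_congr rfl fun j _ => ?_
  rw [smul_apply, matrixUnit, ContinuousLinearMap.smulRight_apply,
    innerSL_apply_apply, entry, real_inner_comm (EuclideanSpace.basisFun (Fin d) ℝ j), smul_comm]

lemma norm_le_sum_abs_entry (T : Param d →L[ℝ] Param d) : ‖T‖ ≤ ∑ i, ∑ j, |entry T i j| := by
  conv_lhs => rw [eq_sum_entry_smul_matrixUnit T]
  refine (norm_sum_le _ _).trans (Finset.sum_le_sum fun i _ => (norm_sum_le _ _).trans
    (Finset.sum_le_sum fun j _ => ?_))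
  rw [norm_smul, Real.norm_eq_abs]
  exact mul_le_of_le_one_right (abs_nonneg _) (norm_matrixUnit_le i j)

/-- The norm of a positive semidefinite operator is at most `d` times its trace. -/
lemma norm_le_mul_sum_entry (T : Param d →L[ℝ] Param d)
    (hsymm : ∀ v w, inner ℝ (T v) w = inner ℝ (T w) v) (hpos : ∀ v, 0 ≤ inner ℝ (T v) v) :
    ‖T‖ ≤ d * ∑ i, entry T i i := by
  -- Positivity on `e_i ± e_j` bounds an off-diagonal entry by the mean of two diagonal ones.
  have h : ∀ i j, |entry T i j| ≤ (entry T i i + entry T j j) / 2 := fun i j => by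
    have h1 := hpos (EuclideanSpace.basisFun (Fin d) ℝ i + EuclideanSpace.basisFun (Fin d) ℝ j)
    have h2 := hpos (EuclideanSpace.basisFun (Fin d) ℝ i - EuclideanSpace.basisFun (Fin d) ℝ j)
    have h3 := hsymm (EuclideanSpace.basisFun (Fin d) ℝ i) (EuclideanSpace.basisFun (Fin d) ℝ j)
    rw [map_add, inner_add_left, inner_add_right, inner_add_right] at h1
    rw [map_sub, inner_sub_left, inner_sub_right, inner_sub_right] at h2
    simp only [entry]
    rw [abs_le]
    constructor <;> linarith
  refine (norm_le_sum_abs_entry T).trans ((Finset.sum_le_sum fun i _ =>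
    Finset.sum_le_sum fun j _ => h i j).trans (le_of_eq ?_))
  simp only [← Finset.sum_div, Finset.sum_add_distrib, Finset.sum_const, Finset.card_univ,
    Fintype.card_fin, nsmul_eq_mul, ← Finset.mul_sum]
  ring

variable {S : Type*} [MeasurableSpace S] {P : Measure S}

lemma measurable_of_inner {g : S → Param d} (h : ∀ v, Measurable fun x => inner ℝ (g x) v) :
    Measurable g := by
  have : g = fun x => ∑ i, inner ℝ (g x) (EuclideanSpace.basisFun (Fin d) ℝ i) •
      EuclideanSpace.basisFun (Fin d) ℝ i := by
    funext x
    conv_lhs => rw [← (EuclideanSpace.basisFun (Fin d) ℝ).sum_repr' (g x)]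
    simp only [real_inner_comm]
  rw [this]
  refine Finset.measurable_fun_sum _ fun i _ => ?_
  exact (h (EuclideanSpace.basisFun (Fin d) ℝ i)).smul_const (EuclideanSpace.basisFun (Fin d) ℝ i)

lemma integrable_of_inner {g : S → Param d} (h : ∀ v, Integrable (fun x => inner ℝ (g x) v) P) :
    Integrable g P := by
  have : g = fun x => ∑ i, inner ℝ (g x) (EuclideanSpace.basisFun (Fin d) ℝ i) •
      EuclideanSpace.basisFun (Fin d) ℝ i := by
    funext x
    conv_lhs => rw [← (EuclideanSpace.basisFun (Fin d) ℝ).sum_repr' (g x)]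
    simp only [real_inner_comm]
  rw [this]
  exact integrable_finsetSum _ fun i _ => (h _).smul_const _

lemma integrable_sum_smul {E : Type*} [NormedAddCommGroup E] [NormedSpace ℝ E]
    {f : S → Fin d → Fin d → ℝ} (e : Fin d → Fin d → E)
    (h : ∀ i j, Integrable (fun x => f x i j) P) :
    Integrable (fun x => ∑ i, ∑ j, f x i j • e i j) P :=
  integrable_finsetSum _ fun i _ => integrable_finsetSum _ fun j _ => (h i j).smul_const _

lemma integrable_of_entry {T : S → Param d →L[ℝ] Param d}
    (h : ∀ i j, Integrable (fun x => entry (T x) i j) P) : Integrable T P := by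
  have : T = fun x => ∑ i, ∑ j, entry (T x) i j • matrixUnit i j :=
    funext fun x => eq_sum_entry_smul_matrixUnit (T x)
  rw [this]
  exact integrable_sum_smul matrixUnit h

lemma integral_inner_apply {T : S → Param d →L[ℝ] Param d} (hT : Integrable T P) (v w : Param d) :
    ∫ x, inner ℝ (T x v) w ∂P = inner ℝ ((∫ x, T x ∂P) v) w := by
  rw [ContinuousLinearMap.integral_apply hT, real_inner_comm,
    ← integral_inner (hT.apply_continuousLinearMap v) w]
  simp only [real_inner_comm]

end Coordinates

/-! ### Measurability of gradients and Hessians in the sample -/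

section Measurability

variable {d : ℕ} {S : Type*} [MeasurableSpace S] {ℓ : Param d → S → ℝ}

/-- The derivative is the pointwise limit of difference quotients with steps `1 / (k + 1)`. Applied
twice, it reaches the Hessian. -/
lemma measurable_slope_limit {g : ℝ → S → ℝ} {g' : S → ℝ} (hg : ∀ s, Measurable (g s))
    (hd : ∀ x, HasDerivAt (fun s => g s x) (g' x) 0) : Measurable g' := by
  refine measurable_of_tendsto_metrizable
    (f := fun (k : ℕ) x => (1 / ((k : ℝ) + 1))⁻¹ * (g (0 + 1 / ((k : ℝ) + 1)) x - g 0 x))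
    (fun k => ((hg _).sub (hg _)).const_mul _) ?_
  rw [tendsto_pi_nhds]
  intro x
  have h1 := (hd x).tendsto_slope_zero
  refine h1.comp ?_
  rw [tendsto_nhdsWithin_iff]
  refine ⟨tendsto_one_div_add_atTop_nhds_zero_nat, Filter.Eventually.of_forall fun k => ?_⟩
  simp only [Set.mem_compl_iff, Set.mem_singleton_iff]
  positivity

lemma measurable_gradient (hm : ∀ θ, Measurable (ℓ θ))
    (hd : ∀ x, Differentiable ℝ (fun θ => ℓ θ x)) (θ : Param d) :
    Measurable fun x => gradient (fun θ => ℓ θ x) θ := by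
  refine measurable_of_inner fun v => measurable_slope_limit (g := fun s x => ℓ (θ + s • v) x)
    (fun s => hm _) fun x => ?_
  have := hasDerivAt_comp_line (hd x) θ v 0
  rwa [zero_smul, add_zero] at this

lemma measurable_inner_hessian (hm : ∀ θ, Measurable (ℓ θ))
    (hd : ∀ x, Differentiable ℝ (fun θ => ℓ θ x))
    (hd2 : ∀ x, Differentiable ℝ (gradient fun θ => ℓ θ x)) (θ v w : Param d) :
    Measurable fun x => inner ℝ (hessian (fun θ => ℓ θ x) θ v) w := by
  refine measurable_slope_limit
    (g := fun s x => inner ℝ (gradient (fun θ => ℓ θ x) (θ + s • v)) w)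
    (fun s => (measurable_gradient hm hd _).inner measurable_const) fun x => ?_
  have := hasDerivAt_inner_gradient_line (hd2 x) θ v w 0
  rwa [zero_smul, add_zero] at this

end Measurability

/-! ### A random bound for the Hessian on the ball -/

section HessianBound

variable {d : ℕ} {S : Type*} {ℓ : Param d → S → ℝ} {θs : Param d} {M : ℝ}

/-- A common bound for the norm and the Lipschitz constant of the Hessian near `θ⋆`. -/
noncomputable def hessianBound (ℓ : Param d → S → ℝ) (θs : Param d) (M : ℝ) (x : S) : ℝ :=
  ‖hessian (fun θ => ℓ θ x) θs‖ + (M + 1) * (hessianLip ℓ θs M x).toReal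

lemma hessianBound_nonneg (hM : 0 ≤ M) (x : S) : 0 ≤ hessianBound ℓ θs M x := by
  unfold hessianBound
  positivity

lemma norm_hessian_sub_le {x : S} (hx : hessianLip ℓ θs M x ≠ ⊤) {θ₁ θ₂ : Param d}
    (h₁ : θ₁ ∈ Metric.closedBall θs M) (h₂ : θ₂ ∈ Metric.closedBall θs M) :
    ‖hessian (fun θ => ℓ θ x) θ₂ - hessian (fun θ => ℓ θ x) θ₁‖ ≤
      (hessianLip ℓ θs M x).toReal * ‖θ₂ - θ₁‖ := by
  rcases eq_or_ne θ₁ θ₂ with rfl | hne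
  · simp
  have hpos : 0 < ‖θ₂ - θ₁‖ := norm_pos_iff.2 (sub_ne_zero.2 hne.symm)
  have h : ENNReal.ofReal
      (‖hessian (fun θ => ℓ θ x) θ₂ - hessian (fun θ => ℓ θ x) θ₁‖ / ‖θ₂ - θ₁‖) ≤
      hessianLip ℓ θs M x :=
    le_iSup₂_of_le θ₁ h₁ (le_iSup₂_of_le θ₂ h₂ (le_iSup_of_le hne le_rfl))
  rw [← div_le_iff₀ hpos]
  exact (ENNReal.ofReal_le_iff_le_toReal hx).1 h

/-- In the factor `M + 1`, the `1` pays for this Lipschitz bound and the `M` for carrying the norm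
from the centre to the whole ball. Finiteness matters: `toReal` sends `⊤` to `0`. -/
lemma norm_hessian_sub_le_hessianBound (hM : 0 ≤ M) {x : S} (hx : hessianLip ℓ θs M x ≠ ⊤)
    {θ₁ θ₂ : Param d}
    (h₁ : θ₁ ∈ Metric.closedBall θs M) (h₂ : θ₂ ∈ Metric.closedBall θs M) :
    ‖hessian (fun θ => ℓ θ x) θ₂ - hessian (fun θ => ℓ θ x) θ₁‖ ≤
      hessianBound ℓ θs M x * ‖θ₂ - θ₁‖ := by
  refine (norm_hessian_sub_le hx h₁ h₂).trans (mul_le_mul_of_nonneg_right ?_ (norm_nonneg _))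
  unfold hessianBound
  nlinarith [norm_nonneg (hessian (fun θ => ℓ θ x) θs),
    mul_nonneg hM (ENNReal.toReal_nonneg (a := hessianLip ℓ θs M x))]

lemma norm_hessian_le_hessianBound (hM : 0 ≤ M) {x : S} (hx : hessianLip ℓ θs M x ≠ ⊤)
    {θ : Param d} (hθ : θ ∈ Metric.closedBall θs M) :
    ‖hessian (fun θ => ℓ θ x) θ‖ ≤ hessianBound ℓ θs M x := by
  have h1 := norm_hessian_sub_le hx (Metric.mem_closedBall_self hM) hθ
  have h2 := norm_sub_norm_le (hessian (fun θ => ℓ θ x) θ) (hessian (fun θ => ℓ θ x) θs)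
  have h3 := mul_le_mul_of_nonneg_left (mem_closedBall_iff_norm.1 hθ)
    (ENNReal.toReal_nonneg (a := hessianLip ℓ θs M x))
  unfold hessianBound
  nlinarith [ENNReal.toReal_nonneg (a := hessianLip ℓ θs M x)]

end HessianBound

/-! ### Population gradient and Hessian -/

section Population

variable {d : ℕ} {S : Type*} [MeasurableSpace S] {P : Measure S}
  {ℓ : Param d → S → ℝ} {θs : Param d} {ρ L M σ τ p : ℝ}

lemma psiTwoNorm_inner_gradient_le (hc : Concentration P ℓ θs M σ τ p) {u : Param d}
    (hu : ‖u‖ = 1) :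
    psiTwoNorm P (fun x => inner ℝ u (gradient (fun θ => ℓ θ x) θs)) ≤ ENNReal.ofReal σ :=
  le_trans (le_iSup₂_of_le u hu le_rfl) hc.gradient_subGaussian

lemma integrable_gradient_center (ht : IsTask P ℓ θs) (hr : Regularity P ℓ θs ρ L M)
    (hc : Concentration P ℓ θs M σ τ p) :
    Integrable (fun x => gradient (fun θ => ℓ θ x) θs) P := by
  refine integrable_of_inner fun v => ?_
  rcases eq_or_ne v 0 with rfl | hv
  · simp
  have h1 := psiTwoNorm_inner_gradient_le hc (norm_smul_inv_norm (𝕜 := ℝ) hv)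
  have h2 := integrable_of_psiTwoNorm_le (measurable_const.inner
    (measurable_gradient ht.measurable hr.differentiable θs)) h1
  refine (h2.const_mul ‖v‖).congr (Filter.Eventually.of_forall fun x => ?_)
  simp only [inner_smul_left, real_inner_comm]
  simp [norm_ne_zero_iff.2 hv]

lemma ae_hessianLip_ne_top (hc : Concentration P ℓ θs M σ τ p) :
    ∀ᵐ x ∂P, hessianLip ℓ θs M x ≠ ⊤ := by
  filter_upwards [ae_lt_top' hc.hessianLip_aemeasurable
    (hc.hessianLip_mean.trans_lt ENNReal.ofReal_lt_top).ne] with x hx using hx.ne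

lemma integrable_hessianLip (hc : Concentration P ℓ θs M σ τ p) :
    Integrable (fun x => (hessianLip ℓ θs M x).toReal) P :=
  integrable_toReal_of_lintegral_ne_top hc.hessianLip_aemeasurable
    (hc.hessianLip_mean.trans_lt ENNReal.ofReal_lt_top).ne

/-- Mean value inequality from the centre. The bound does not depend on `θ`, so it can dominate when
differentiating under the expectation. -/
lemma norm_gradient_le (hr : Regularity P ℓ θs ρ L M) (hM : 0 ≤ M) {x : S}
    (hx : hessianLip ℓ θs M x ≠ ⊤) {θ : Param d} (hθ : θ ∈ Metric.closedBall θs M) :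
    ‖gradient (fun θ => ℓ θ x) θ‖ ≤
      ‖gradient (fun θ => ℓ θ x) θs‖ + M * hessianBound ℓ θs M x := by
  have h1 := (convex_closedBall θs M).norm_image_sub_le_of_norm_hasFDerivWithin_le
    (f := gradient fun θ => ℓ θ x) (f' := hessian fun θ => ℓ θ x)
    (fun θ _ => (hr.differentiable_gradient x θ).hasFDerivAt.hasFDerivWithinAt)
    (fun θ hθ => norm_hessian_le_hessianBound hM hx hθ) (Metric.mem_closedBall_self hM) hθ
  have h2 := norm_sub_norm_le (gradient (fun θ => ℓ θ x) θ) (gradient (fun θ => ℓ θ x) θs)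
  have h3 := mul_le_mul_of_nonneg_left (mem_closedBall_iff_norm.1 hθ)
    (hessianBound_nonneg (ℓ := ℓ) (θs := θs) hM x)
  linarith

variable [IsProbabilityMeasure P]

lemma memLp_inner_hessian (ht : IsTask P ℓ θs) (hr : Regularity P ℓ θs ρ L M)
    (hc : Concentration P ℓ θs M σ τ p) {θ : Param d} (hθ : θ ∈ Metric.closedBall θs M)
    (v : Param d) : MemLp (fun x => inner ℝ (hessian (fun θ => ℓ θ x) θ v) v) 2 P := by
  rcases eq_or_ne v 0 with rfl | hv
  · simp
  have hu : ‖‖v‖⁻¹ • v‖ = 1 := norm_smul_inv_norm hv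
  set u := ‖v‖⁻¹ • v with hu_def
  have hvu : v = ‖v‖ • u := by rw [hu_def, smul_inv_smul₀ (norm_ne_zero_iff.2 hv)]
  have hmeas := measurable_inner_hessian ht.measurable hr.differentiable
    hr.differentiable_gradient θ u u
  have h1 := eLpNorm_le_of_psiOneNorm_le (hc.hessian_subExponential θ hθ u hu) (q := 2)
    (by norm_num)
  rw [show ENNReal.ofReal 2 = 2 by norm_num] at h1
  -- The expected Hessian is not yet known to exist as an integral, but it enters only as a constant
  -- shift, so a default value `0` would do no harm.
  have h2 : MemLp (fun x => inner ℝ (hessian (fun θ => ℓ θ x) θ u) u -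
      inner ℝ ((∫ y, hessian (fun θ' => ℓ θ' y) θ ∂P) u) u) 2 P := by
    refine ⟨(hmeas.sub_const _).aestronglyMeasurable, ?_⟩
    simp only [sub_apply, inner_sub_left] at h1
    exact h1.trans_lt ENNReal.ofReal_lt_top
  have h3 := (h2.add (memLp_const (inner ℝ ((∫ y, hessian (fun θ' => ℓ θ' y) θ ∂P) u) u))).const_mul
    (‖v‖ * ‖v‖)
  convert h3 using 2 with x
  rw [hvu]
  simp only [map_smul, inner_smul_left, inner_smul_right, Pi.add_apply, sub_add_cancel]
  simp [norm_smul, hu]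
  ring

/-- Polarization: by symmetry, every entry is a combination of quadratic forms, which are square
integrable. -/
lemma integrable_hessian (ht : IsTask P ℓ θs) (hr : Regularity P ℓ θs ρ L M)
    (hc : Concentration P ℓ θs M σ τ p) {θ : Param d} (hθ : θ ∈ Metric.closedBall θs M) :
    Integrable (fun x => hessian (fun θ => ℓ θ x) θ) P := by
  refine integrable_of_entry fun i j => ?_
  have h := fun v => (memLp_inner_hessian ht hr hc hθ v).integrable (by norm_num)
  have h2 := (((h (EuclideanSpace.basisFun (Fin d) ℝ i + EuclideanSpace.basisFun (Fin d) ℝ j)).sub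
    (h (EuclideanSpace.basisFun (Fin d) ℝ i))).sub
    (h (EuclideanSpace.basisFun (Fin d) ℝ j))).div_const 2
  refine h2.congr (Filter.Eventually.of_forall fun x => ?_)
  simp only [Pi.sub_apply, entry]
  rw [map_add, inner_add_left, inner_add_right, inner_add_right,
    inner_hessian_comm (hr.differentiable x) (hr.differentiable_gradient x) θ
      (EuclideanSpace.basisFun (Fin d) ℝ j) (EuclideanSpace.basisFun (Fin d) ℝ i)]
  ring

lemma integrable_hessianBound (ht : IsTask P ℓ θs) (hr : Regularity P ℓ θs ρ L M) (hM : 0 ≤ M)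
    (hc : Concentration P ℓ θs M σ τ p) : Integrable (hessianBound ℓ θs M) P :=
  (integrable_hessian ht hr hc (Metric.mem_closedBall_self hM)).norm.add
    ((integrable_hessianLip hc).const_mul _)

lemma integrable_gradient_bound (ht : IsTask P ℓ θs) (hr : Regularity P ℓ θs ρ L M) (hM : 0 ≤ M)
    (hc : Concentration P ℓ θs M σ τ p) :
    Integrable (fun x => ‖gradient (fun θ => ℓ θ x) θs‖ + M * hessianBound ℓ θs M x) P :=
  (integrable_gradient_center ht hr hc).norm.add ((integrable_hessianBound ht hr hM hc).const_mul _)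

lemma integrable_gradient (ht : IsTask P ℓ θs) (hr : Regularity P ℓ θs ρ L M) (hM : 0 ≤ M)
    (hc : Concentration P ℓ θs M σ τ p) {θ : Param d} (hθ : θ ∈ Metric.closedBall θs M) :
    Integrable (fun x => gradient (fun θ => ℓ θ x) θ) P := by
  refine (integrable_gradient_bound ht hr hM hc).mono'
    (measurable_gradient ht.measurable hr.differentiable θ).aestronglyMeasurable ?_
  filter_upwards [ae_hessianLip_ne_top hc] with x hx using norm_gradient_le hr hM hx hθ

/-- Differentiation of the population loss under the expectation. -/
lemma hasGradientAt_popLoss (ht : IsTask P ℓ θs) (hr : Regularity P ℓ θs ρ L M)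
    (hc : Concentration P ℓ θs M σ τ p) {θ : Param d} (hθ : θ ∈ Metric.ball θs M) :
    HasGradientAt (popLoss P ℓ) (∫ x, gradient (fun θ => ℓ θ x) θ ∂P) θ := by
  have hM : 0 ≤ M := dist_nonneg.trans (Metric.mem_ball.1 hθ).le
  have hint := integrable_gradient ht hr hM hc (Metric.ball_subset_closedBall hθ)
  have h := hasFDerivAt_integral_of_dominated_of_fderiv_le (μ := P) (F := ℓ) (x₀ := θ)
    (F' := fun θ x => innerSL ℝ (gradient (fun θ => ℓ θ x) θ))
    (Metric.isOpen_ball.mem_nhds hθ)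
    (Filter.Eventually.of_forall fun θ => (ht.measurable θ).aestronglyMeasurable)
    (ht.integrable θ)
    ((innerSL ℝ).continuous.comp_aestronglyMeasurable hint.aestronglyMeasurable)
    (by
      filter_upwards [ae_hessianLip_ne_top hc] with x hx θ' hθ'
      rw [innerSL_apply_norm]
      exact norm_gradient_le hr hM hx (Metric.ball_subset_closedBall hθ'))
    (integrable_gradient_bound ht hr hM hc)
    (Filter.Eventually.of_forall fun x θ' _ => (hr.differentiable x θ').hasGradientAt.hasFDerivAt)
  rw [ContinuousLinearMap.integral_comp_comm (innerSL ℝ) hint] at h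
  exact h

/-- The Hessian of the population loss is the expected Hessian. -/
lemma hessian_popLoss (ht : IsTask P ℓ θs) (hr : Regularity P ℓ θs ρ L M)
    (hc : Concentration P ℓ θs M σ τ p) {θ : Param d} (hθ : θ ∈ Metric.ball θs M) :
    hessian (popLoss P ℓ) θ = ∫ x, hessian (fun θ => ℓ θ x) θ ∂P := by
  have hM : 0 ≤ M := dist_nonneg.trans (Metric.mem_ball.1 hθ).le
  have h := hasFDerivAt_integral_of_dominated_of_fderiv_le (μ := P)
    (F := fun θ x => gradient (fun θ => ℓ θ x) θ) (x₀ := θ)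
    (F' := fun θ x => hessian (fun θ => ℓ θ x) θ)
    (Metric.isOpen_ball.mem_nhds hθ)
    (Filter.Eventually.of_forall fun θ =>
      (measurable_gradient ht.measurable hr.differentiable θ).aestronglyMeasurable)
    (integrable_gradient ht hr hM hc (Metric.ball_subset_closedBall hθ))
    (integrable_hessian ht hr hc (Metric.ball_subset_closedBall hθ)).aestronglyMeasurable
    (by
      filter_upwards [ae_hessianLip_ne_top hc] with x hx θ' hθ' using
        norm_hessian_le_hessianBound hM hx (Metric.ball_subset_closedBall hθ'))
    (integrable_hessianBound ht hr hM hc)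
    (Filter.Eventually.of_forall fun x θ' _ => (hr.differentiable_gradient x θ').hasFDerivAt)
  -- The formula for the population gradient is available only on the open ball, hence the passage
  -- through eventual equality.
  refine HasFDerivAt.fderiv (h.congr_of_eventuallyEq ?_)
  filter_upwards [Metric.isOpen_ball.mem_nhds hθ] with θ' hθ' using
    (hasGradientAt_popLoss ht hr hc hθ').gradient

/-- First-order optimality of `θs` for the population loss; it centres the variables in the Chernoff
bound for the gradient. -/
lemma integral_inner_gradient_eq_zero (ht : IsTask P ℓ θs) (hr : Regularity P ℓ θs ρ L M)
    (hM : 0 < M) (hc : Concentration P ℓ θs M σ τ p) (u : Param d) :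
    ∫ x, inner ℝ u (gradient (fun θ => ℓ θ x) θs) ∂P = 0 := by
  have h := hasGradientAt_popLoss ht hr hc (Metric.mem_ball_self hM)
  rw [integral_inner (integrable_gradient_center ht hr hc), ← h.gradient, gradient,
    (ht.isMin.isLocalMin Filter.univ_mem).fderiv_eq_zero, map_zero, inner_zero_right]

lemma integral_inner_hessian (ht : IsTask P ℓ θs) (hr : Regularity P ℓ θs ρ L M)
    (hc : Concentration P ℓ θs M σ τ p) {θ : Param d} (hθ : θ ∈ Metric.ball θs M) (v : Param d) :
    ∫ x, inner ℝ (hessian (fun θ => ℓ θ x) θ v) v ∂P = inner ℝ (hessian (popLoss P ℓ) θ v) v := by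
  rw [hessian_popLoss ht hr hc hθ,
    integral_inner_apply (integrable_hessian ht hr hc (Metric.ball_subset_closedBall hθ))]

/-- Second moment of the curvature of the loss in a direction. -/
lemma integral_inner_hessian_sq_le (ht : IsTask P ℓ θs) (hr : Regularity P ℓ θs ρ L M)
    (hρ : 0 ≤ ρ) (hc : Concentration P ℓ θs M σ τ p) {θ : Param d} (hθ : θ ∈ Metric.ball θs M)
    {v : Param d} (hv : ‖v‖ = 1) :
    ∫ x, inner ℝ (hessian (fun θ => ℓ θ x) θ v) v ^ 2 ∂P ≤ L ^ 2 + 4 * τ ^ 4 := by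
  have hθ' := Metric.ball_subset_closedBall hθ
  set Y := fun x => inner ℝ (hessian (fun θ => ℓ θ x) θ v) v with hY
  have hL := memLp_inner_hessian ht hr hc hθ' v
  have hmean := integral_inner_hessian ht hr hc hθ v
  have h1 := eLpNorm_le_of_psiOneNorm_le (hc.hessian_subExponential θ hθ' v hv) (q := 2)
    (by norm_num)
  simp only [sub_apply, inner_sub_left,
    ← integral_inner_apply (integrable_hessian ht hr hc hθ')] at h1
  -- The `ψ₁` bound at `q = 2` gives a centred `L²` norm of at most `2 * τ ^ 2`.
  have h2 : variance Y P ≤ 4 * τ ^ 4 := by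
    have h3 : evariance Y P ≤ ENNReal.ofReal (4 * τ ^ 4) := by
      rw [evariance]
      have h4 : eLpNorm (fun x => Y x - ∫ y, Y y ∂P) 2 P ^ (2 : ℝ) =
          ∫⁻ x, ‖Y x - ∫ y, Y y ∂P‖ₑ ^ 2 ∂P := by
        have := eLpNorm_nnreal_pow_eq_lintegral (f := fun x => Y x - ∫ y, Y y ∂P) (μ := P)
          (p := 2) (by norm_num)
        simpa using this
      rw [← h4]
      calc eLpNorm (fun x => Y x - ∫ y, Y y ∂P) 2 P ^ (2 : ℝ)
          ≤ ENNReal.ofReal (τ ^ 2 * 2) ^ (2 : ℝ) := by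
            rw [show ENNReal.ofReal 2 = 2 by norm_num] at h1
            gcongr
        _ = _ := by
            rw [ENNReal.rpow_ofNat, ← ENNReal.ofReal_pow (by positivity)]
            congr 1
            ring
    exact ENNReal.toReal_le_of_le_ofReal (by positivity) h3
  rw [variance_eq_sub hL] at h2
  have hlow := hr.hessian_lower θ hθ' v
  have hup := hr.hessian_upper θ hθ' v
  rw [hv] at hlow hup
  have h5 : (∫ x, Y x ∂P) ^ 2 ≤ L ^ 2 := by
    rw [hmean]
    exact pow_le_pow_left₀ (by linarith) (by linarith) 2
  have h6 : ∫ x, Y x ^ 2 ∂P - (∫ x, Y x ∂P) ^ 2 ≤ 4 * τ ^ 4 := h2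
  linarith

/-- A positive semidefinite Hessian has norm at most `d` times its trace, and the expected trace is
at most `d * L`. Polynomial growth in `d` suffices, since the bound enters the net size only through
a logarithm. -/
lemma integral_hessianBound_le (ht : IsTask P ℓ θs) (hr : Regularity P ℓ θs ρ L M) (hM : 0 < M)
    (hc : Concentration P ℓ θs M σ τ p) (hτ : 0 ≤ τ) :
    ∫ x, hessianBound ℓ θs M x ∂P ≤ d ^ 2 * L + (M + 1) * (τ ^ 3 * (d : ℝ) ^ p) := by
  have hs := Metric.mem_ball_self (x := θs) hM
  have hi := integrable_hessian ht hr hc (Metric.mem_closedBall_self hM.le)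
  have hie : ∀ i, Integrable (fun x => entry (hessian (fun θ => ℓ θ x) θs) i i) P := fun i =>
    (memLp_inner_hessian ht hr hc (Metric.mem_closedBall_self hM.le) _).integrable (by norm_num)
  have h1 : ∫ x, ‖hessian (fun θ => ℓ θ x) θs‖ ∂P ≤ d ^ 2 * L := by
    calc ∫ x, ‖hessian (fun θ => ℓ θ x) θs‖ ∂P
        ≤ ∫ x, d * ∑ i, entry (hessian (fun θ => ℓ θ x) θs) i i ∂P :=
          integral_mono hi.norm ((integrable_finsetSum _ fun i _ => hie i).const_mul _)
            fun x => norm_le_mul_sum_entry _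
              (inner_hessian_comm (hr.differentiable x) (hr.differentiable_gradient x) θs)
              (inner_hessian_nonneg (hr.convex x) (hr.differentiable x)
                (hr.differentiable_gradient x) θs)
      _ = d * ∑ i, ∫ x, entry (hessian (fun θ => ℓ θ x) θs) i i ∂P := by
          rw [integral_const_mul, integral_finsetSum _ fun i _ => hie i]
      _ ≤ d * ∑ _i : Fin d, L := by
          gcongr with i
          have h2 := hr.hessian_upper θs (Metric.mem_closedBall_self hM.le)
            (EuclideanSpace.basisFun (Fin d) ℝ i)
          rw [← integral_inner_hessian ht hr hc hs] at h2
          simpa [entry] using h2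
      _ = _ := by
          simp only [Finset.sum_const, Finset.card_univ, Fintype.card_fin, nsmul_eq_mul]
          ring
  have h2 : ∫ x, (hessianLip ℓ θs M x).toReal ∂P ≤ τ ^ 3 * (d : ℝ) ^ p := by
    rw [integral_toReal hc.hessianLip_aemeasurable (by
      filter_upwards [ae_hessianLip_ne_top hc] with x hx using hx.lt_top)]
    exact ENNReal.toReal_le_of_le_ofReal (by positivity) hc.hessianLip_mean
  unfold hessianBound
  rw [integral_add hi.norm ((integrable_hessianLip hc).const_mul _), integral_const_mul]
  gcongr

end Population

/-! ### Derivatives of the empirical loss -/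

section Empirical

variable {d N : ℕ} {S : Type*} {ℓ : Param d → S → ℝ}

lemma differentiable_empLoss (hd : ∀ x, Differentiable ℝ (fun θ => ℓ θ x)) (x : Fin N → S) :
    Differentiable ℝ (empLoss ℓ x) :=
  (Differentiable.fun_sum fun i _ => hd (x i)).const_mul _

lemma convexOn_empLoss (hc : ∀ x, ConvexOn ℝ Set.univ (fun θ => ℓ θ x)) (x : Fin N → S) :
    ConvexOn ℝ Set.univ (empLoss ℓ x) := by
  have h : ∀ T : Finset (Fin N), ConvexOn ℝ Set.univ (fun θ => ∑ i ∈ T, ℓ θ (x i)) := fun T => by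
    classical
    induction T using Finset.induction_on with
    | empty => simpa using convexOn_const (0 : ℝ) convex_univ
    | insert i T hi ih =>
      simp only [Finset.sum_insert hi]
      exact (hc (x i)).add ih
  exact (h Finset.univ).smul (by positivity)

lemma gradient_empLoss (hd : ∀ x, Differentiable ℝ (fun θ => ℓ θ x)) (x : Fin N → S) :
    gradient (empLoss ℓ x) =
      fun θ => (1 / (N : ℝ)) • ∑ i, gradient (fun θ => ℓ θ (x i)) θ := by
  funext θ
  refine HasGradientAt.gradient ?_
  rw [hasGradientAt_iff_hasFDerivAt, map_smul, map_sum]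
  exact (HasFDerivAt.fun_sum fun i _ => (hd (x i) θ).hasGradientAt.hasFDerivAt).const_mul _

lemma differentiable_gradient_empLoss (hd : ∀ x, Differentiable ℝ (fun θ => ℓ θ x))
    (hd2 : ∀ x, Differentiable ℝ (gradient fun θ => ℓ θ x)) (x : Fin N → S) :
    Differentiable ℝ (gradient (empLoss ℓ x)) := by
  rw [gradient_empLoss hd]
  exact (Differentiable.fun_sum fun i _ => hd2 (x i)).const_smul (1 / (N : ℝ))

lemma hessian_empLoss (hd : ∀ x, Differentiable ℝ (fun θ => ℓ θ x))
    (hd2 : ∀ x, Differentiable ℝ (gradient fun θ => ℓ θ x)) (x : Fin N → S) (θ : Param d) :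
    hessian (empLoss ℓ x) θ = (1 / (N : ℝ)) • ∑ i, hessian (fun θ => ℓ θ (x i)) θ := by
  rw [hessian, gradient_empLoss hd]
  exact ((HasFDerivAt.fun_sum fun i _ => (hd2 (x i) θ).hasFDerivAt).const_smul (1 / (N : ℝ))).fderiv

lemma inner_hessian_empLoss (hd : ∀ x, Differentiable ℝ (fun θ => ℓ θ x))
    (hd2 : ∀ x, Differentiable ℝ (gradient fun θ => ℓ θ x)) (x : Fin N → S) (θ v : Param d) :
    inner ℝ (hessian (empLoss ℓ x) θ v) v =
      (1 / (N : ℝ)) * ∑ i, inner ℝ (hessian (fun θ => ℓ θ (x i)) θ v) v := by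
  rw [hessian_empLoss hd hd2, smul_apply, sum_apply, real_inner_smul_left, sum_inner]

end Empirical

/-! ### Perturbation of a quadratic form -/

section QuadraticForm

variable {d : ℕ}

/-- Replacing the operator and then each of the two arguments costs at most `δ * G` each time. -/
lemma inner_apply_self_ge (T T₀ : Param d →L[ℝ] Param d) {v v₀ : Param d} (hv : ‖v‖ = 1)
    (hv₀ : ‖v₀‖ = 1) {G δ : ℝ} (hT₀ : ‖T₀‖ ≤ G) (hTT : ‖T - T₀‖ ≤ G * δ) (hvv : ‖v - v₀‖ ≤ δ) :
    inner ℝ (T₀ v₀) v₀ - 3 * δ * G ≤ inner ℝ (T v) v := by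
  have h1 : inner ℝ (T v) v = inner ℝ (T₀ v₀) v₀ + inner ℝ ((T - T₀) v) v +
      inner ℝ (T₀ (v - v₀)) v + inner ℝ (T₀ v₀) (v - v₀) := by
    simp only [sub_apply, map_sub, inner_sub_left, inner_sub_right]
    ring
  have hG : 0 ≤ G := (norm_nonneg _).trans hT₀
  have hδ : 0 ≤ δ := (norm_nonneg _).trans hvv
  have h2 : ‖inner ℝ ((T - T₀) v) v‖ ≤ G * δ := by
    refine (norm_inner_le_norm _ _).trans ?_
    rw [hv, mul_one]
    refine ((T - T₀).le_opNorm v).trans ?_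
    rwa [hv, mul_one]
  have h3 : ‖inner ℝ (T₀ (v - v₀)) v‖ ≤ G * δ := by
    refine (norm_inner_le_norm _ _).trans ?_
    rw [hv, mul_one]
    exact (T₀.le_opNorm _).trans (mul_le_mul hT₀ hvv (norm_nonneg _) hG)
  have h4 : ‖inner ℝ (T₀ v₀) (v - v₀)‖ ≤ G * δ := by
    refine (norm_inner_le_norm _ _).trans ?_
    refine mul_le_mul ?_ hvv (norm_nonneg _) hG
    refine (T₀.le_opNorm v₀).trans ?_
    rwa [hv₀, mul_one]
  rw [Real.norm_eq_abs] at h2 h3 h4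
  linarith [(abs_le.1 h2).1, (abs_le.1 h3).1, (abs_le.1 h4).1]

end QuadraticForm

/-! ### High-probability bounds for one task -/

section Tails

variable {d N : ℕ} {S Ω : Type*} [MeasurableSpace S] [MeasurableSpace Ω] {P : Measure S}
  [IsProbabilityMeasure P] {μ : Measure Ω} [IsProbabilityMeasure μ] {ξ : Fin N → Ω → S}
  {ℓ : Param d → S → ℝ} {θs : Param d} {ρ L M σ τ p : ℝ}

/-- Deviation of the empirical gradient at the population minimizer. -/
lemma measure_gradient_empLoss_gt_le (hlaw : ∀ i, HasLaw (ξ i) P μ) (hind : iIndepFun ξ μ)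
    (ht : IsTask P ℓ θs) (hr : Regularity P ℓ θs ρ L M) (hM : 0 < M)
    (hc : Concentration P ℓ θs M σ τ p) {c : ℝ} (hc0 : 0 < c) (hσ : σ ≤ c) (hd : 1 ≤ d)
    (hN : 0 < N) {s : ℝ} (hs : 0 ≤ s) (hsN : d + s ≤ N) :
    μ {ω | 48 * c * Real.sqrt ((d + s) / N) < ‖gradient (empLoss ℓ fun i => ξ i ω) θs‖} ≤
      ENNReal.ofReal (Real.exp (-s - 2)) := by
  have hN' : (0 : ℝ) < N := by exact_mod_cast hN
  have hd' : (1 : ℝ) ≤ d := by exact_mod_cast hd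
  set D : ℝ := d + s with hD
  have hD0 : 0 < D := by linarith
  set r := Real.sqrt (D / N) with hr_def
  have hr0 : 0 < r := Real.sqrt_pos.2 (by positivity)
  have hr2 : r ^ 2 = D / N := Real.sq_sqrt (by positivity)
  have hr1 : r ^ 2 ≤ 1 := by rw [hr2]; exact (div_le_one hN').2 hsN
  obtain ⟨T, hT1, hTcard, hT⟩ := exists_half_net (Metric.sphere (0 : Param d) 1) 0 one_pos
    Metric.sphere_subset_closedBall
  have hsub : {ω | 48 * c * r < ‖gradient (empLoss ℓ fun i => ξ i ω) θs‖} ⊆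
      ⋃ u ∈ T, {ω | N * (24 * c * r) ≤
        ∑ i, inner ℝ u (gradient (fun θ => ℓ θ (ξ i ω)) θs)} := by
    intro ω hω
    rw [Set.mem_ofPred_eq] at hω
    set g := gradient (empLoss ℓ fun i => ξ i ω) θs with hg
    have hg0 : 0 < ‖g‖ := lt_trans (by positivity) hω
    -- A net point within `1 / 2` of the direction of `g` captures at least half of `‖g‖`, so the
    -- threshold drops from `48` to `24`.
    obtain ⟨u, hu, hdist⟩ := hT (‖g‖⁻¹ • g)
      (by simpa using norm_smul_inv_norm (𝕜 := ℝ) (norm_pos_iff.1 hg0))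
    simp only [Set.mem_iUnion, Set.mem_ofPred_eq]
    refine ⟨u, hu, ?_⟩
    have h1 : inner ℝ u g = ‖g‖ - inner ℝ (‖g‖⁻¹ • g - u) g := by
      rw [inner_sub_left, real_inner_smul_left, real_inner_self_eq_norm_sq]
      field_simp
      ring
    have h2 := (real_inner_le_norm (‖g‖⁻¹ • g - u) g).trans
      (mul_le_mul_of_nonneg_right hdist hg0.le)
    have h3 : inner ℝ u g = 1 / (N : ℝ) *
        ∑ i, inner ℝ u (gradient (fun θ => ℓ θ (ξ i ω)) θs) := by
      rw [hg, gradient_empLoss hr.differentiable, real_inner_smul_right, inner_sum]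
    have h4 : 24 * c * r ≤ 1 / (N : ℝ) *
        ∑ i, inner ℝ u (gradient (fun θ => ℓ θ (ξ i ω)) θs) := by
      rw [← h3, h1]
      linarith
    rw [one_div, ← div_eq_inv_mul, le_div_iff₀ hN'] at h4
    linarith
  have hterm : ∀ u ∈ T, μ {ω | N * (24 * c * r) ≤
      ∑ i, inner ℝ u (gradient (fun θ => ℓ θ (ξ i ω)) θs)} ≤
      ENNReal.ofReal (Real.exp (-(5 * D))) := fun u hu => by
    have hu1 : ‖u‖ = 1 := by simpa using hT1 hu
    have hX : Measurable fun x => inner ℝ u (gradient (fun θ => ℓ θ x) θs) :=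
      measurable_const.inner (measurable_gradient ht.measurable hr.differentiable θs)
    have hpsi := (psiTwoNorm_inner_gradient_le hc hu1).trans (ENNReal.ofReal_le_ofReal hσ)
    -- The tilt `r / (4 * c)` is admissible because `r ≤ 1`. The exponent becomes `21 / 4 * D`,
    -- which beats the net entropy `2 * d` and leaves `s + 2`.
    have hsc : 12 * c ^ 2 * (r / (4 * c)) ^ 2 = 3 / 4 * r ^ 2 := by
      field_simp
      norm_num
    have hsc1 : 12 * c ^ 2 * (r / (4 * c)) ^ 2 ≤ 1 := by rw [hsc]; linarith
    refine (measure_sum_ge_le_exp hlaw hind hX (by positivity)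
      (integrable_exp_of_psiTwoNorm_le hX hc0.le hpsi hsc1)
      (integral_exp_le_of_psiTwoNorm_le hX hc0.le hpsi
        (integral_inner_gradient_eq_zero ht hr hM hc u) hsc1)).trans ?_
    refine ENNReal.ofReal_le_ofReal (Real.exp_le_exp.2 (neg_le_neg ?_))
    rw [hsc, show r / (4 * c) * (24 * c * r) = 6 * r ^ 2 by field_simp; norm_num, hr2,
      show (N : ℝ) * (6 * (D / N) - 3 / 4 * (D / N)) = 21 / 4 * D by field_simp; norm_num]
    linarith
  calc μ {ω | 48 * c * r < ‖gradient (empLoss ℓ fun i => ξ i ω) θs‖}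
      ≤ ∑ u ∈ T, ENNReal.ofReal (Real.exp (-(5 * D))) :=
        (measure_mono hsub).trans ((measure_biUnion_finset_le _ _).trans
          (Finset.sum_le_sum hterm))
    _ = ENNReal.ofReal (T.card * Real.exp (-(5 * D))) := by
        rw [Finset.sum_const, nsmul_eq_mul, ENNReal.ofReal_mul (Nat.cast_nonneg _),
          ENNReal.ofReal_natCast]
    _ ≤ _ := by
        refine ENNReal.ofReal_le_ofReal ?_
        have h5 : (T.card : ℝ) ≤ Real.exp (2 * d) := by
          calc (T.card : ℝ) ≤ 5 ^ d := by exact_mod_cast hTcard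
            _ ≤ Real.exp 2 ^ d := by
              refine pow_le_pow_left₀ (by norm_num) ?_ _
              have h := Real.exp_one_gt_d9
              have : Real.exp 2 = Real.exp 1 * Real.exp 1 := by rw [← Real.exp_add]; norm_num
              nlinarith
            _ = _ := by rw [← Real.exp_nat_mul, mul_comm]
        refine (mul_le_mul_of_nonneg_right h5 (Real.exp_pos _).le).trans ?_
        rw [← Real.exp_add]
        refine Real.exp_le_exp.2 ?_
        linarith

/-- Uniform lower bound for the empirical Hessian near the population minimizer. -/
lemma measure_hessian_empLoss_lt_le (hlaw : ∀ i, HasLaw (ξ i) P μ) (hind : iIndepFun ξ μ)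
    (ht : IsTask P ℓ θs) (hr : Regularity P ℓ θs ρ L M) (hρ : 0 < ρ) (hM : 0 < M)
    (hc : Concentration P ℓ θs M σ τ p) (hN : 0 < N) {V R δ : ℝ} (hV0 : 0 < V)
    (hV : L ^ 2 + 4 * τ ^ 4 ≤ V) (hR : 0 < R) (hδ : 0 < δ) (hδM : δ ≤ M) (hδ1 : δ ≤ 1)
    (hRδ : 12 * (δ * R) ≤ ρ) :
    μ {ω | ¬ ∀ θ ∈ Metric.ball θs M, ∀ v : Param d,
        ρ / 2 * ‖v‖ ^ 2 ≤ inner ℝ (hessian (empLoss ℓ fun i => ξ i ω) θ v) v} ≤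
      ENNReal.ofReal ((∫ x, hessianBound ℓ θs M x ∂P) / R) +
        ENNReal.ofReal (Real.exp (d * (12 + 3 * Real.log (M / δ) + 3 * Real.log (1 / δ)) -
          N * (ρ ^ 2 / (32 * V)))) := by
  have hN' : (0 : ℝ) < N := by exact_mod_cast hN
  obtain ⟨T₁, hT₁, hcard₁, hnet₁⟩ := exists_net (Metric.ball θs M) θs hδ hδM
    Metric.ball_subset_closedBall
  obtain ⟨T₂, hT₂, hcard₂, hnet₂⟩ := exists_net (Metric.sphere (0 : Param d) 1) 0 hδ hδ1
    Metric.sphere_subset_closedBall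
  have hlip : ∀ᵐ ω ∂μ, ∀ i, hessianLip ℓ θs M (ξ i ω) ≠ ⊤ := ae_all_iff.2 fun i => by
    have := (hlaw i).map_eq.symm ▸ ae_hessianLip_ne_top hc
    exact ae_of_ae_map (hlaw i).aemeasurable this
  have hsub : {ω | ¬ ∀ θ ∈ Metric.ball θs M, ∀ v : Param d,
        ρ / 2 * ‖v‖ ^ 2 ≤ inner ℝ (hessian (empLoss ℓ fun i => ξ i ω) θ v) v} ⊆
      {ω | ¬ ∀ i, hessianLip ℓ θs M (ξ i ω) ≠ ⊤} ∪
      ({ω | N * R ≤ ∑ i, hessianBound ℓ θs M (ξ i ω)} ∪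
        ⋃ q ∈ T₁ ×ˢ T₂, {ω | N * (-(3 / 4 * ρ)) ≤
          ∑ i, -inner ℝ (hessian (fun θ => ℓ θ (ξ i ω)) q.1 q.2) q.2}) := by
    intro ω hω
    by_contra hgood
    simp only [Set.mem_union, Set.mem_ofPred_eq, Set.mem_iUnion, not_or, not_not, not_le,
      not_exists] at hgood
    obtain ⟨hfin, hG, hq⟩ := hgood
    refine hω fun θ hθ v => ?_
    suffices hunit : ∀ u : Param d, ‖u‖ = 1 →
        ρ / 2 ≤ inner ℝ (hessian (empLoss ℓ fun i => ξ i ω) θ u) u by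
      rcases eq_or_ne v 0 with rfl | hv
      · simp
      have h := hunit _ (norm_smul_inv_norm (𝕜 := ℝ) hv)
      have hvn := norm_pos_iff.2 hv
      simp only [map_smul, inner_smul_left, inner_smul_right] at h
      simp only [RCLike.ofReal_real_eq_id, id_eq, map_inv₀, conj_trivial] at h
      rw [← mul_assoc, ← mul_inv, ← div_eq_inv_mul, le_div_iff₀ (by positivity)] at h
      rwa [sq]
    intro u hu
    obtain ⟨θ₀, hθ₀, hθd⟩ := hnet₁ θ hθ
    obtain ⟨u₀, hu₀, hud⟩ := hnet₂ u (by simpa using hu)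
    have hu₀1 : ‖u₀‖ = 1 := by simpa using hT₂ hu₀
    have h1 := hq (θ₀, u₀) (Finset.mk_mem_product hθ₀ hu₀)
    rw [Finset.sum_neg_distrib] at h1
    have h2 : ∀ i, inner ℝ (hessian (fun θ => ℓ θ (ξ i ω)) θ₀ u₀) u₀ -
        3 * δ * hessianBound ℓ θs M (ξ i ω) ≤
        inner ℝ (hessian (fun θ => ℓ θ (ξ i ω)) θ u) u := fun i =>
      inner_apply_self_ge _ _ hu hu₀1
        (norm_hessian_le_hessianBound hM.le (hfin i) (Metric.ball_subset_closedBall (hT₁ hθ₀)))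
        ((norm_hessian_sub_le_hessianBound hM.le (hfin i)
          (Metric.ball_subset_closedBall (hT₁ hθ₀)) (Metric.ball_subset_closedBall hθ)).trans
          (mul_le_mul_of_nonneg_left hθd (hessianBound_nonneg hM.le _))) hud
    have h3 := Finset.sum_le_sum fun i (_ : i ∈ Finset.univ) => h2 i
    rw [Finset.sum_sub_distrib, ← Finset.mul_sum] at h3
    rw [inner_hessian_empLoss hr.differentiable hr.differentiable_gradient, one_div,
      ← div_eq_inv_mul, le_div_iff₀ hN']
    -- The average is at least `3 / 4 * ρ` on the net, and the discretization loses at most `3 * δ *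
    -- R ≤ ρ / 4`.
    have h4 := mul_le_mul_of_nonneg_left hG.le (show 0 ≤ 3 * δ by positivity)
    nlinarith
  have hterm : ∀ q ∈ T₁ ×ˢ T₂, μ {ω | N * (-(3 / 4 * ρ)) ≤
          ∑ i, -inner ℝ (hessian (fun θ => ℓ θ (ξ i ω)) q.1 q.2) q.2} ≤
      ENNReal.ofReal (Real.exp (-(N * (ρ ^ 2 / (32 * V))))) := fun q hq => by
    obtain ⟨hq1, hq2⟩ := Finset.mem_product.1 hq
    have hθ := hT₁ hq1
    have hu : ‖q.2‖ = 1 := by simpa using hT₂ hq2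
    have hY := measurable_inner_hessian ht.measurable hr.differentiable
      hr.differentiable_gradient q.1 q.2 q.2
    have hY0 := fun x => inner_hessian_nonneg (hr.convex x) (hr.differentiable x)
      (hr.differentiable_gradient x) q.1 q.2
    -- This tilt maximizes `s * ρ / 4 - s ^ 2 * V / 2`, with value `ρ ^ 2 / (32 * V)`.
    have hs : 0 ≤ ρ / (4 * V) := by positivity
    have hmean : ρ ≤ ∫ x, inner ℝ (hessian (fun θ => ℓ θ x) q.1 q.2) q.2 ∂P := by
      have := hr.hessian_lower q.1 (Metric.ball_subset_closedBall hθ) q.2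
      rw [integral_inner_hessian ht hr hc hθ]
      simpa [hu] using this
    have hsq := (integral_inner_hessian_sq_le ht hr hρ.le hc hθ hu).trans hV
    have hmgf := integral_exp_neg_le hY hY0
      (memLp_inner_hessian ht hr hc (Metric.ball_subset_closedBall hθ) q.2) hs
    have hmgf' := hmgf.trans (Real.exp_le_exp.2 (add_le_add
      (neg_le_neg (mul_le_mul_of_nonneg_left hmean hs))
      (mul_le_mul_of_nonneg_left hsq (by positivity))))
    refine (measure_sum_ge_le_exp hlaw hind hY.neg hs
      (integrable_exp_neg_of_nonneg hY hY0 hs) hmgf').trans (le_of_eq ?_)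
    congr 3
    field_simp
    ring
  calc μ {ω | ¬ ∀ θ ∈ Metric.ball θs M, ∀ v : Param d,
        ρ / 2 * ‖v‖ ^ 2 ≤ inner ℝ (hessian (empLoss ℓ fun i => ξ i ω) θ v) v}
      ≤ μ {ω | ¬ ∀ i, hessianLip ℓ θs M (ξ i ω) ≠ ⊤} +
        (μ {ω | N * R ≤ ∑ i, hessianBound ℓ θs M (ξ i ω)} +
          μ (⋃ q ∈ T₁ ×ˢ T₂, {ω | N * (-(3 / 4 * ρ)) ≤
            ∑ i, -inner ℝ (hessian (fun θ => ℓ θ (ξ i ω)) q.1 q.2) q.2})) :=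
        (measure_mono hsub).trans ((measure_union_le _ _).trans
          (add_le_add le_rfl (measure_union_le _ _)))
    _ ≤ 0 + (ENNReal.ofReal ((∫ x, hessianBound ℓ θs M x ∂P) / R) +
          ∑ q ∈ T₁ ×ˢ T₂, ENNReal.ofReal (Real.exp (-(N * (ρ ^ 2 / (32 * V)))))) := by
        refine add_le_add (le_of_eq hlip) (add_le_add ?_ ?_)
        · exact measure_sum_ge_le_div hlaw (integrable_hessianBound ht hr hM.le hc)
            (Filter.Eventually.of_forall fun x => hessianBound_nonneg hM.le x) hR hN
        · exact (measure_biUnion_finset_le _ _).trans (Finset.sum_le_sum hterm)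
    _ ≤ _ := by
        rw [zero_add, Finset.sum_const, nsmul_eq_mul, ← ENNReal.ofReal_natCast,
          ← ENNReal.ofReal_mul (Nat.cast_nonneg _)]
        refine add_le_add le_rfl (ENNReal.ofReal_le_ofReal ?_)
        rw [Finset.card_product, Nat.cast_mul]
        refine (mul_le_mul_of_nonneg_right (mul_le_mul hcard₁ hcard₂ (Nat.cast_nonneg _)
          (Real.exp_pos _).le) (Real.exp_pos _).le).trans (le_of_eq ?_)
        rw [← Real.exp_add, ← Real.exp_add]
        congr 1
        ring

end Tails

/-- Choice of the truncation level, the mesh of the net and the sample size in terms of the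
constants of the model. -/
lemma exists_tuning {c₁ c₂ c : ℝ} (hc₁ : 0 < c₁) (hc₂ : 0 < c₂) (hc : 0 < c) :
    ∃ ε V : ℝ, 0 < ε ∧ ε ≤ 1 ∧ 0 < V ∧ c₂ ^ 2 + 4 * c ^ 4 ≤ V ∧
      ∀ (d N : ℕ) (s : ℝ), 1 ≤ d → 0 ≤ s → d * (1 + Real.log d + s) ≤ ε * N →
        d + s ≤ N ∧ 48 * c * Real.sqrt ((d + s) / N) < c₁ * c₁ / 8 ∧
        ∃ R δ : ℝ, 0 < R ∧ 0 < δ ∧ δ ≤ c₁ ∧ δ ≤ 1 ∧ 12 * (δ * R) ≤ c₁ ∧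
          (d ^ 2 * c₂ + (c₂ + 1) * (c ^ 3 * (d : ℝ) ^ c)) / R ≤ Real.exp (-s) / 4 ∧
          d * (12 + 3 * Real.log (c₂ / δ) + 3 * Real.log (1 / δ)) - N * (c₁ ^ 2 / (32 * V)) ≤
            -s - 2 := by
  set V : ℝ := c₂ ^ 2 + 4 * c ^ 4 with hV
  have hV0 : 0 < V := by positivity
  set κ : ℝ := c₁ ^ 2 / (32 * V) with hκ
  have hκ0 : 0 < κ := by positivity
  set K : ℝ := c₂ + (c₂ + 1) * c ^ 3 + 1 + c₁ with hK
  have hK1 : 1 ≤ K := by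
    have : 0 < (c₂ + 1) * c ^ 3 := by positivity
    linarith
  have hKc : c₁ ≤ K := by
    have : 0 < (c₂ + 1) * c ^ 3 := by positivity
    linarith
  set A : ℝ := |12 + 3 * (Real.log (12 * c₂ / c₁) + Real.log (12 / c₁)) + 6 * Real.log (4 * K)| +
    6 * (c + 2) + 6 with hA
  have hA0 : 0 < A := by positivity
  -- The three terms give, in turn, `d + s ≤ N`, a small enough gradient (as `48 / 500 < 1 / 8`),
  -- and domination of the net entropy by the Chernoff exponent.
  set ε : ℝ := min 1 (min ((c₁ * c₁ / (500 * c)) ^ 2) (κ / (A + 2))) with hε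
  have hε0 : 0 < ε := by positivity
  have hε1 : ε ≤ 1 := min_le_left _ _
  have hε2 : ε ≤ (c₁ * c₁ / (500 * c)) ^ 2 := (min_le_right _ _).trans (min_le_left _ _)
  have hε3 : (A + 2) * ε ≤ κ := by
    have h : ε ≤ κ / (A + 2) := (min_le_right _ _).trans (min_le_right _ _)
    rw [le_div_iff₀ (by positivity)] at h
    linarith
  refine ⟨ε, V, hε0, hε1, hV0, le_rfl, fun d N s hd hs hX => ?_⟩
  have hd' : (1 : ℝ) ≤ d := by exact_mod_cast hd
  have hlog : 0 ≤ Real.log d := Real.log_nonneg hd'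
  set X : ℝ := d * (1 + Real.log d + s) with hXdef
  have hDX : d + s ≤ X := by nlinarith [mul_nonneg (sub_nonneg.2 hd') hs]
  have hN : (0 : ℝ) < N := by
    by_contra h
    have : (N : ℝ) = 0 := le_antisymm (not_lt.1 h) (Nat.cast_nonneg _)
    rw [this, mul_zero] at hX
    linarith
  refine ⟨?_, ?_, ?_⟩
  · nlinarith
  · have h1 : Real.sqrt ((d + s) / N) ≤ c₁ * c₁ / (500 * c) := by
      rw [← Real.sqrt_sq (show 0 ≤ c₁ * c₁ / (500 * c) by positivity)]
      refine Real.sqrt_le_sqrt (le_trans ?_ hε2)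
      rw [div_le_iff₀ hN]
      linarith
    calc 48 * c * Real.sqrt ((d + s) / N) ≤ 48 * c * (c₁ * c₁ / (500 * c)) := by gcongr
      _ = c₁ * c₁ * (48 / 500) := by field_simp
      _ < c₁ * c₁ / 8 := by nlinarith [mul_pos hc₁ hc₁]
  -- The factor `exp s` makes Markov fail with probability at most `exp (-s) / 4`, and `d ^ (c + 2)`
  -- covers both powers of `d` in the mean. Hence `log R` is linear in `s` and `log d`.
  set R : ℝ := 4 * K * Real.exp s * (d : ℝ) ^ (c + 2) with hR
  have hdc : 1 ≤ (d : ℝ) ^ (c + 2) := Real.one_le_rpow hd' (by linarith)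
  have hes : 1 ≤ Real.exp s := Real.one_le_exp hs
  have hRK : K ≤ R := by
    have h1 : 1 ≤ Real.exp s * (d : ℝ) ^ (c + 2) := one_le_mul_of_one_le_of_one_le hes hdc
    rw [hR, mul_assoc]
    nlinarith
  have hR0 : 0 < R := by linarith
  have hlogR : Real.log R = Real.log (4 * K) + s + (c + 2) * Real.log d := by
    rw [hR, Real.log_mul (by positivity) (by positivity), Real.log_mul (by positivity)
      (Real.exp_pos _).ne', Real.log_exp, Real.log_rpow (by linarith)]
  refine ⟨R, c₁ / (12 * R), hR0, by positivity, ?_, ?_, ?_, ?_, ?_⟩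
  · exact div_le_self hc₁.le (by linarith)
  · rw [div_le_one (by positivity)]
    linarith
  · field_simp
    norm_num
  · have h1 : (d : ℝ) ^ 2 ≤ (d : ℝ) ^ (c + 2) := by
      rw [← Real.rpow_natCast]
      exact Real.rpow_le_rpow_of_exponent_le hd' (by push_cast; linarith)
    have h2 : (d : ℝ) ^ c ≤ (d : ℝ) ^ (c + 2) :=
      Real.rpow_le_rpow_of_exponent_le hd' (by linarith)
    rw [div_le_iff₀ hR0]
    calc d ^ 2 * c₂ + (c₂ + 1) * (c ^ 3 * (d : ℝ) ^ c)
        ≤ (d : ℝ) ^ (c + 2) * c₂ + (c₂ + 1) * (c ^ 3 * (d : ℝ) ^ (c + 2)) := by gcongr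
      _ = (c₂ + (c₂ + 1) * c ^ 3) * (d : ℝ) ^ (c + 2) := by ring
      _ ≤ K * (d : ℝ) ^ (c + 2) := by
        gcongr
        linarith
      _ = Real.exp (-s) / 4 * R := by
        rw [hR, Real.exp_neg]
        field_simp
  · have h1 : Real.log (c₂ / (c₁ / (12 * R))) = Real.log (12 * c₂ / c₁) + Real.log R := by
      rw [← Real.log_mul (by positivity) hR0.ne']
      congr 1
      field_simp
    have h2 : Real.log (1 / (c₁ / (12 * R))) = Real.log (12 / c₁) + Real.log R := by
      rw [← Real.log_mul (by positivity) hR0.ne']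
      congr 1
      field_simp
    have h3 := le_abs_self
      (12 + 3 * (Real.log (12 * c₂ / c₁) + Real.log (12 / c₁)) + 6 * Real.log (4 * K))
    have h3' := abs_nonneg
      (12 + 3 * (Real.log (12 * c₂ / c₁) + Real.log (12 / c₁)) + 6 * Real.log (4 * K))
    have h4 : d * (12 + 3 * (Real.log (12 * c₂ / c₁) + Real.log R) +
        3 * (Real.log (12 / c₁) + Real.log R)) ≤ A * X := by
      rw [hXdef, ← mul_assoc, mul_comm A, mul_assoc]
      refine mul_le_mul_of_nonneg_left ?_ (by linarith)
      rw [hlogR, hA]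
      have h5 : 0 ≤ c * s := by positivity
      have h6 := mul_nonneg h3' (add_nonneg hlog hs)
      linarith
    have h7 : (A + 2) * X ≤ κ * N := by
      calc (A + 2) * X ≤ (A + 2) * (ε * N) := by gcongr
        _ = (A + 2) * ε * N := by ring
        _ ≤ κ * N := by gcongr
    have h8 : s + 2 ≤ 2 * X := by linarith
    have h9 : (A + 2) * X = A * X + 2 * X := by ring
    rw [h1, h2]
    linarith

/-! ### One task -/

section Task

variable {d N : ℕ} {S Ω : Type*} [MeasurableSpace S] [MeasurableSpace Ω] {P : Measure S}
  [IsProbabilityMeasure P] {μ : Measure Ω} [IsProbabilityMeasure μ] {ξ : Fin N → Ω → S}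
  {ℓ : Param d → S → ℝ} {θs : Param d} {ρ L M σ τ p : ℝ}

/-- With high probability, the empirical loss of one task has a unique minimizer, which is close
to the population minimizer and stable under exact penalties. -/
theorem measure_exists_minimizer_compl_le {c₁ c₂ c s R δ V : ℝ} (hlaw : ∀ i, HasLaw (ξ i) P μ)
    (hind : iIndepFun ξ μ) (ht : IsTask P ℓ θs) (hr : Regularity P ℓ θs ρ L M)
    (hc : Concentration P ℓ θs M σ τ p) (hc₁ : 0 < c₁) (hρ : c₁ < ρ) (hM : c₁ < M)
    (hL : c₁ < L) (hL₂ : L < c₂) (hM₂ : M < c₂) (hc0 : 0 < c) (hσ : σ ≤ c) (hτ : 0 ≤ τ)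
    (hτc : τ ≤ c) (hp : p ≤ c) (hd : 1 ≤ d) (hN : 0 < N) (hs : 0 ≤ s)
    (hV0 : 0 < V) (hV : c₂ ^ 2 + 4 * c ^ 4 ≤ V)
    (hsN : d + s ≤ N) (hsmall : 48 * c * Real.sqrt ((d + s) / N) < c₁ * c₁ / 8)
    (hR : 0 < R) (hδ : 0 < δ) (hδc : δ ≤ c₁) (hδ1 : δ ≤ 1) (hRδ : 12 * (δ * R) ≤ c₁)
    (hB : (d ^ 2 * c₂ + (c₂ + 1) * (c ^ 3 * (d : ℝ) ^ c)) / R ≤ Real.exp (-s) / 4)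
    (hnet : d * (12 + 3 * Real.log (c₂ / δ) + 3 * Real.log (1 / δ)) - N * (c₁ ^ 2 / (32 * V)) ≤
      -s - 2) :
    μ {ω | ¬ ∃ θt : Param d,
        {θ | IsMinOn (empLoss ℓ fun i => ξ i ω) Set.univ θ} = {θt} ∧
        ‖θt - θs‖ ≤ 96 * c / c₁ * Real.sqrt ((d + s) / N) ∧
        ∀ lam : ℝ, 0 ≤ lam → lam < ρ * M / 4 → ∀ θ : Param d,
          (∀ θ', empLoss ℓ (fun i => ξ i ω) θ ≤
            empLoss ℓ (fun i => ξ i ω) θ' + lam * ‖θ - θ'‖) → ‖θ - θt‖ ≤ 2 * lam / ρ} ≤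
      ENNReal.ofReal (Real.exp (-s)) := by
  have hρ0 : 0 < ρ := hc₁.trans hρ
  have hM0 : 0 < M := hc₁.trans hM
  have hL0 : 0 < L := hc₁.trans hL
  have hc₂ : 0 < c₂ := hL0.trans hL₂
  have hd' : (1 : ℝ) ≤ d := by exact_mod_cast hd
  have hsub : {ω | ¬ ∃ θt : Param d,
        {θ | IsMinOn (empLoss ℓ fun i => ξ i ω) Set.univ θ} = {θt} ∧
        ‖θt - θs‖ ≤ 96 * c / c₁ * Real.sqrt ((d + s) / N) ∧
        ∀ lam : ℝ, 0 ≤ lam → lam < ρ * M / 4 → ∀ θ : Param d,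
          (∀ θ', empLoss ℓ (fun i => ξ i ω) θ ≤
            empLoss ℓ (fun i => ξ i ω) θ' + lam * ‖θ - θ'‖) → ‖θ - θt‖ ≤ 2 * lam / ρ} ⊆
      {ω | 48 * c * Real.sqrt ((d + s) / N) < ‖gradient (empLoss ℓ fun i => ξ i ω) θs‖} ∪
      {ω | ¬ ∀ θ ∈ Metric.ball θs M, ∀ v : Param d,
        ρ / 2 * ‖v‖ ^ 2 ≤ inner ℝ (hessian (empLoss ℓ fun i => ξ i ω) θ v) v} := by
    intro ω hω
    by_contra hgood
    simp only [Set.mem_union, Set.mem_ofPred_eq, not_or, not_not, not_lt] at hgood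
    obtain ⟨hgrad, hhess⟩ := hgood
    refine hω ?_
    obtain ⟨θt, h1, h2, h3⟩ := exists_minimizer_of_curvature
      (convexOn_empLoss hr.convex fun i => ξ i ω)
      (differentiable_empLoss hr.differentiable fun i => ξ i ω)
      (differentiable_gradient_empLoss hr.differentiable hr.differentiable_gradient
        fun i => ξ i ω) hρ0 hM0 hhess
      (by
        have := mul_lt_mul'' hρ hM hc₁.le hc₁.le
        linarith)
    refine ⟨θt, h1, h2.trans ?_, h3⟩
    calc 2 / ρ * ‖gradient (empLoss ℓ fun i => ξ i ω) θs‖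
        ≤ 2 / c₁ * (48 * c * Real.sqrt ((d + s) / N)) := by gcongr
      _ = _ := by ring
  have hG := measure_gradient_empLoss_gt_le hlaw hind ht hr hM0 hc hc0 hσ hd hN hs hsN
  have hH := measure_hessian_empLoss_lt_le hlaw hind ht hr hρ0 hM0 hc hN hV0
    (le_trans (by gcongr) hV) hR hδ (hδc.trans hM.le) hδ1 (hRδ.trans hρ.le)
  have hB' : (∫ x, hessianBound ℓ θs M x ∂P) / R ≤ Real.exp (-s) / 4 := by
    refine le_trans ?_ hB
    have h1 := integral_hessianBound_le ht hr hM0 hc hτ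
    have h2 : (d : ℝ) ^ p ≤ (d : ℝ) ^ c := Real.rpow_le_rpow_of_exponent_le hd' hp
    refine div_le_div_of_nonneg_right (h1.trans ?_) hR.le
    gcongr
  have hnet' : d * (12 + 3 * Real.log (M / δ) + 3 * Real.log (1 / δ)) - N * (ρ ^ 2 / (32 * V)) ≤
      -s - 2 := by
    refine le_trans ?_ hnet
    gcongr
  -- Three failures (gradient, Lipschitz constant, curvature on the net) each cost at most a quarter
  -- of `exp (-s)`.
  have hexp : Real.exp (-s - 2) ≤ Real.exp (-s) / 4 := by
    rw [Real.exp_sub]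
    refine div_le_div_of_nonneg_left (Real.exp_pos _).le (by norm_num) ?_
    have h := Real.exp_one_gt_d9
    have : Real.exp 2 = Real.exp 1 * Real.exp 1 := by rw [← Real.exp_add]; norm_num
    nlinarith
  refine (measure_mono hsub).trans ((measure_union_le _ _).trans
    ((add_le_add hG hH).trans ?_))
  rw [← ENNReal.ofReal_add (div_nonneg (integral_nonneg fun x => hessianBound_nonneg hM0.le x)
    hR.le) (Real.exp_pos _).le, ← ENNReal.ofReal_add (Real.exp_pos _).le (add_nonneg (div_nonneg
    (integral_nonneg fun x => hessianBound_nonneg hM0.le x) hR.le) (Real.exp_pos _).le)]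
  refine ENNReal.ofReal_le_ofReal ?_
  have := Real.exp_le_exp.2 hnet'
  linarith [Real.exp_pos (-s)]

end Task

/-! ### Columns of an ARMUL solution -/

section Solution

variable {d m : ℕ} {w lam : Fin m → ℝ} {f : Fin m → Param d → ℝ} {Om : Set (Fin m → Param d)}
  {Θ Γ : Fin m → Param d}

/-- Each column of a solution minimizes its own loss up to an exact penalty. -/
lemma IsSolution.le_add_mul_norm (h : IsSolution w lam f Om Θ Γ) {j : Fin m} (hw : 0 < w j)
    (hlam : 0 ≤ lam j) (θ : Param d) : f j (Θ j) ≤ f j θ + lam j * ‖Θ j - θ‖ := by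
  -- Only column `j` of `Θ` changes and `Γ` is kept, so the competitor is feasible for every
  -- constraint set.
  have h1 := h.2 (Function.update Θ j θ) Γ h.1
  unfold objective at h1
  rw [← Finset.add_sum_erase _ _ (Finset.mem_univ j),
    ← Finset.add_sum_erase _ _ (Finset.mem_univ j), Finset.sum_congr rfl (fun i hi => by
      rw [← Function.update_of_ne (Finset.ne_of_mem_erase hi) θ Θ] :
      ∀ i ∈ Finset.univ.erase j, w i * (f i (Θ i) + lam i * ‖Θ i - Γ i‖) =
        w i * (f i (Function.update Θ j θ i) + lam i * ‖Function.update Θ j θ i - Γ i‖)),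
    add_le_add_iff_right, Function.update_self] at h1
  have h2 := le_of_mul_le_mul_left h1 hw
  have h3 := mul_le_mul_of_nonneg_left (norm_sub_le_norm_sub_add_norm_sub θ (Θ j) (Γ j)) hlam
  rw [norm_sub_rev θ (Θ j)] at h3
  linarith

end Solution

/-- The sample size condition of the theorem, in the form used for one task. -/
lemma sample_size_le {ε n d l t : ℝ} (hε : 0 < ε) (hε1 : ε ≤ 1) (hn : 2 ≤ n) (hd : 1 ≤ d)
    (hl : Real.log 2 ≤ l) (h : n > 16 / ε * d * Real.log n * l)
    (ht : t < ε / 4 * n / (d * Real.log n)) : d * (1 + Real.log d + (t + l)) ≤ ε * n := by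
  have hlog2 : (1 : ℝ) / 2 ≤ Real.log 2 := by linarith [Real.log_two_gt_d9]
  have hlogn : (1 : ℝ) / 2 ≤ Real.log n := hlog2.trans (Real.log_le_log (by norm_num) hn)
  have hl' : (1 : ℝ) / 2 ≤ l := hlog2.trans hl
  have hd0 : 0 < d := by linarith
  have h1 : 16 * (d * Real.log n * l) ≤ ε * n := by
    have h2 : 16 / ε * d * Real.log n * l = 16 * (d * Real.log n * l) / ε := by ring
    rw [h2, gt_iff_lt, div_lt_iff₀ hε] at h
    linarith
  have hdn : 1 / 2 * d ≤ d * Real.log n := by nlinarith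
  have h3 : d * Real.log n * (1 / 2) ≤ d * Real.log n * l :=
    mul_le_mul_of_nonneg_left hl' (by positivity)
  have h4 : 1 / 2 * d * l ≤ d * Real.log n * l := mul_le_mul_of_nonneg_right hdn (by linarith)
  have h5 : d ≤ n := by nlinarith
  have h6 : d * Real.log d ≤ d * Real.log n :=
    mul_le_mul_of_nonneg_left (Real.log_le_log hd0 h5) hd0.le
  have h7 : d * t ≤ ε * n / 2 := by
    have hpos : 0 < d * Real.log n := by positivity
    rw [lt_div_iff₀ hpos] at ht
    rcases le_or_gt t 0 with h0 | h0
    · have : d * t ≤ 0 := mul_nonpos_of_nonneg_of_nonpos hd0.le h0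
      have : 0 ≤ ε * n := by positivity
      linarith
    · have := mul_le_mul_of_nonneg_left hdn h0.le
      linarith
  have h8 : 0 ≤ ε * n := by positivity
  -- As `log n` and `l` are at least `1 / 2`, the terms `d`, `d * log d`, `d * l` total at most `8 *
  -- (d * log n * l) ≤ ε * n / 2`; the other half of `ε * n` absorbs `d * t`.
  nlinarith

end ARMUL

/-! ### Union bound over the tasks -/

theorem mainTheorem5 (c₁ c₂ c : ℝ) (hc₁ : 0 < c₁) (hc₂ : 0 < c₂) (hc : 0 < c) :
    ∃ C C₁ C₂ : ℝ, 0 < C ∧ 0 < C₁ ∧ 0 < C₂ ∧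
      ∀ (d m : ℕ) (_ : 1 ≤ d) (_ : 2 ≤ m)
        -- the tasks
        (S : Fin m → Type*) [∀ j, MeasurableSpace (S j)]
        (P : ∀ j, Measure (S j)) [∀ j, IsProbabilityMeasure (P j)]
        (ℓ : ∀ j, ARMUL.Param d → S j → ℝ) (θs : Fin m → ARMUL.Param d)
        (_ : ∀ j, ARMUL.IsTask (P j) (ℓ j) (θs j))
        -- regularity and concentration
        (ρ L M : ℝ) (_ : c₁ < ρ ∧ ρ < c₂) (_ : c₁ < L ∧ L < c₂) (_ : c₁ < M ∧ M < c₂)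
        (_ : ∀ j, ARMUL.Regularity (P j) (ℓ j) (θs j) ρ L M)
        (σ τ p : ℝ) (_ : 0 ≤ σ ∧ σ < c) (_ : 0 ≤ τ ∧ τ < c) (_ : 0 ≤ p ∧ p < c)
        (_ : ∀ j, ARMUL.Concentration (P j) (ℓ j) (θs j) M σ τ p)
        -- the independent data sets, each of them i.i.d.
        (n : Fin m → ℕ) (_ : 2 ≤ ⨅ j, n j)
        (Ω : Type*) [MeasurableSpace Ω] (μ : Measure Ω) [IsProbabilityMeasure μ]
        (ξ : ∀ j, Fin (n j) → Ω → S j)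
        (_ : ∀ j i, HasLaw (ξ j i) (P j) μ)
        (_ : iIndepFun (fun (a : Σ j, Fin (n j)) => ξ a.1 a.2) μ)
        -- weights, penalty levels and confidence level
        (w lam : Fin m → ℝ) (_ : ∀ j, 0 < w j) (_ : ∀ j, 0 ≤ lam j)
        (_ : ∀ j, lam j < ρ * M / 4)
        (_ : ((⨅ j, n j : ℕ) : ℝ) > C₁ * d * Real.log (⨅ j, n j : ℕ) * Real.log m)
        (t : ℝ) (_ : 0 ≤ t) (_ : t < C₂ * (⨅ j, n j : ℕ) / (d * Real.log (⨅ j, n j : ℕ))),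
        ∃ A : Set Ω, MeasurableSet A ∧ 1 - Real.exp (-t) ≤ μ.real A ∧
          ∀ ω ∈ A, ∃ θt : Fin m → ARMUL.Param d,
            (∀ j,
              {θ | IsMinOn (ARMUL.empLoss (ℓ j) (fun i => ξ j i ω)) Set.univ θ} = {θt j} ∧
              ‖θt j - θs j‖ ≤ C * Real.sqrt ((d + Real.log m + t) / n j)) ∧
            ∀ (Om : Set (Fin m → ARMUL.Param d)) (Θ Γ : Fin m → ARMUL.Param d),
              ARMUL.IsSolution w lam (fun j => ARMUL.empLoss (ℓ j) (fun i => ξ j i ω)) Om Θ Γ →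
              ∀ j, ‖Θ j - θt j‖ ≤ 2 * lam j / ρ := by
  obtain ⟨ε, V, hε, hε1, hV0, hV, hεV⟩ := ARMUL.exists_tuning hc₁ hc₂ hc
  refine ⟨96 * c / c₁, 16 / ε, ε / 4, by positivity, by positivity, by positivity, ?_⟩
  intro d m hd hm S _ P _ ℓ θs htask ρ L M hρ hL hM hreg σ τ p hσ hτ hp hconc n hn Ω _ μ _ ξ hlaw
    hind w lam hw hlam hlamρ hsize t ht0 ht
  have hlogm : Real.log 2 ≤ Real.log m :=
    Real.log_le_log (by norm_num) (by exact_mod_cast hm)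
  have hm0 : (0 : ℝ) < m := by exact_mod_cast (by omega : 0 < m)
  have hs : 0 ≤ t + Real.log m := by linarith [Real.log_two_gt_d9]
  have hX := ARMUL.sample_size_le hε hε1 (by exact_mod_cast hn) (by exact_mod_cast hd) hlogm
    hsize ht
  -- Each task is run at level `t + log m`, so that `m` failures total `exp (-t)`. The event covers
  -- all admissible penalties at once and involves neither weights nor constraint set.
  let good : Fin m → Ω → ARMUL.Param d → Prop := fun j ω θt =>
    {θ | IsMinOn (ARMUL.empLoss (ℓ j) fun i => ξ j i ω) Set.univ θ} = {θt} ∧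
    ‖θt - θs j‖ ≤ 96 * c / c₁ * Real.sqrt ((d + (t + Real.log m)) / n j) ∧
    ∀ lam : ℝ, 0 ≤ lam → lam < ρ * M / 4 → ∀ θ : ARMUL.Param d,
      (∀ θ', ARMUL.empLoss (ℓ j) (fun i => ξ j i ω) θ ≤
        ARMUL.empLoss (ℓ j) (fun i => ξ j i ω) θ' + lam * ‖θ - θ'‖) → ‖θ - θt‖ ≤ 2 * lam / ρ
  have hbad : ∀ j, μ {ω | ¬ ∃ θt, good j ω θt} ≤
      ENNReal.ofReal (Real.exp (-(t + Real.log m))) := fun j => by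
    have hnj : (⨅ j, n j) ≤ n j := ciInf_le' n j
    have hnj' : ((⨅ j, n j : ℕ) : ℝ) ≤ n j := by exact_mod_cast hnj
    obtain ⟨h1, h2, R, δ, h3, h4, h5, h6, h7, h8, h9⟩ := hεV d (n j) (t + Real.log m) hd hs
      (hX.trans (mul_le_mul_of_nonneg_left hnj' hε.le))
    have hindj : iIndepFun (ξ j) μ :=
      hind.precomp (g := fun i : Fin (n j) => (⟨j, i⟩ : Σ j, Fin (n j))) 
        (sigma_mk_injective (β := fun j => Fin (n j)))
    exact ARMUL.measure_exists_minimizer_compl_le (hlaw j) hindj (htask j) (hreg j) (hconc j) hc₁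
      hρ.1 hM.1 hL.1 hL.2 hM.2 hc hσ.2.le hτ.1 hτ.2.le hp.2.le hd (by omega) hs hV0 hV h1 h2 h3 h4
      h5 h6 h7 h8 h9
  set B : Set Ω := ⋃ j, {ω | ¬ ∃ θt, good j ω θt} with hB
  have hμB : μ B ≤ ENNReal.ofReal (Real.exp (-t)) := by
    refine (measure_iUnion_fintype_le μ _).trans ((Finset.sum_le_sum fun j _ => hbad j).trans
      (le_of_eq ?_))
    rw [Finset.sum_const, Finset.card_univ, Fintype.card_fin, nsmul_eq_mul,
      ← ENNReal.ofReal_natCast, ← ENNReal.ofReal_mul hm0.le, neg_add, Real.exp_add,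
      Real.exp_neg (Real.log m), Real.exp_log hm0]
    congr 1
    field_simp
  -- The bad set need not be measurable; its measurable hull has the same measure.
  refine ⟨(toMeasurable μ B)ᶜ, (measurableSet_toMeasurable μ B).compl, ?_, fun ω hω => ?_⟩
  · rw [probReal_compl_eq_one_sub (measurableSet_toMeasurable μ B), measureReal_def,
      measure_toMeasurable]
    have := ENNReal.toReal_le_of_le_ofReal (Real.exp_pos _).le hμB
    linarith
  · have hωB : ∀ j, ∃ θt, good j ω θt := fun j => by
      by_contra h
      exact hω (subset_toMeasurable μ B (Set.mem_iUnion.2 ⟨j, h⟩))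
    choose θt h1 h2 h3 using hωB
    refine ⟨θt, fun j => ⟨h1 j, ?_⟩, fun Om Θ Γ hsol j =>
      h3 j (lam j) (hlam j) (hlamρ j) (Θ j) (hsol.le_add_mul_norm (hw j) (hlam j))⟩
    rw [show (d : ℝ) + Real.log m + t = d + (t + Real.log m) by ring]
    exact h2 j
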